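/- Let $R$ be a commutative Noetherian local ring which is complete with respect to its maximal ideal, let $\Lambda$ be an $R$-algebra (not necessarily commutative) which is finitely generated as an $R$-module, and let $\mathfrak a\subsetneq R$ be a proper ideal such that $\operatorname{Tor}^R_n(\Lambda,R/\mathfrak a)=0$ for all $n>0$. Put $\overline\Lambda=\Lambda/\mathfrak a\Lambda$. Modules are right modules; $D(\Lambda)$ is the derived category of all $\Lambda$-modules, $D^-(\operatorname{mod}\Lambda)\subseteq D(\Lambda)$ is the full subcategory of objects isomorphic to bounded above complexes of finitely generated $\Lambda$-modules, and an object of $D(\Lambda)$ is perfect if it is isomorphic to a bounded complex of finitely generated projective $\Lambda$-modules. Let $$F\colon D^-(\operatorname{mod}\Lambda)\to D(\overline\Lambda),\qquad M\mapsto \overline M:=M\otimes^{\mathbb L}_{\Lambda}\overline\Lambda$$ be the reduction functor. For objects $X,Y$ of $D(\Lambda)$ or of $D(\overline\Lambda)$ write $X\ge Y$ if $\operatorname{Hom}(X,Y[i])=0$ for all $i>0$, and $X\perp Y$ if $\operatorname{Hom}(X,Y[i])=0$ for all $i\in\mathbb Z$. Let $L$ be perfect over $\Lambda$ and $M\in D^-(\operatorname{mod}\Lambda)$.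 Then: 1. $L\ge M$ if and only if $\overline L\ge\overline M$; and in this case $F$ is full at $(L,M)$, that is, the map $\operatorname{Hom}_{D(\Lambda)}(L,M)\to\operatorname{Hom}_{D(\overline\Lambda)}(\overline L,\overline M)$, $\varphi\mapsto F(\varphi)$, is surjective. 2. $L\perp M$ if and only if $\overline L\perp\overline M$. 3. If $L$ is presilting (that is, $L$ is perfect and $L\ge L$), then there is an isomorphism of $R/\mathfrak a$-algebras $\operatorname{End}_{D(\Lambda)}(L)\otimes_R R/\mathfrak a\cong\operatorname{End}_{D(\overline\Lambda)}(\overline L)$ (in particular an isomorphism of $S$-algebras for every commutative ring $S$ over which $R/\mathfrak a$ is an algebra). -/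

import Mathlib

open CategoryTheory CategoryTheory.Limits
open scoped TensorProduct

universe w w' u

noncomputable section

/-! ### Extension of scalars along a homomorphism of (noncommutative) rings -/

namespace NCExtendScalars

variable {A B : Type u} [Ring A] [Ring B] (f : A →+* B)

/-- The relations `b f(a) ⊗ m = b ⊗ a m` that turn `B ⊗_ℤ M` into `B ⊗_A M`.
The set of relations is stable under left multiplication by `B`, so the
`B`-submodule it spans is also the additive subgroup it spans. -/
def relations (M : Type u) [AddCommGroup M] [Module A M] : Submodule B (B ⊗[ℤ] M) :=
  Submodule.span B
    {t | ∃ (b : B) (a : A) (m : M), t = (b * f a) ⊗ₜ[ℤ] m - b ⊗ₜ[ℤ] (a • m)}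

/-- The map `B ⊗_A M → B ⊗_A N` induced by an `A`-linear map `g : M → N`. -/
def mapLinear {M N : Type u} [AddCommGroup M] [Module A M] [AddCommGroup N] [Module A N]
    (g : M →ₗ[A] N) :
    ((B ⊗[ℤ] M) ⧸ relations f M) →ₗ[B] ((B ⊗[ℤ] N) ⧸ relations f N) :=
  Submodule.mapQ _ _
    (TensorProduct.AlgebraTensorModule.map (LinearMap.id : B →ₗ[B] B) g.toAddMonoidHom.toIntLinearMap)
    (by
      rw [relations, Submodule.span_le]
      rintro _ ⟨b, a, m, rfl⟩
      simp only [SetLike.mem_coe, Submodule.mem_comap, map_sub]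
      exact Submodule.subset_span ⟨b, a, g m, by simp⟩)

@[simp]
theorem mapLinear_mk_tmul {M N : Type u} [AddCommGroup M] [Module A M] [AddCommGroup N]
    [Module A N] (g : M →ₗ[A] N) (b : B) (m : M) :
    mapLinear f g (Submodule.Quotient.mk (b ⊗ₜ[ℤ] m)) = Submodule.Quotient.mk (b ⊗ₜ[ℤ] g m) :=
  rfl

theorem hom_ext {M : Type u} [AddCommGroup M] [Module A M] {N : Type u} [AddCommGroup N]
    [Module B N] {g h : ((B ⊗[ℤ] M) ⧸ relations f M) →ₗ[B] N}
    (H : ∀ (b : B) (m : M), g (Submodule.Quotient.mk (b ⊗ₜ[ℤ] m)) =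
      h (Submodule.Quotient.mk (b ⊗ₜ[ℤ] m))) : g = h := by
  refine Submodule.linearMap_qext _ (LinearMap.ext fun x => ?_)
  induction x using TensorProduct.induction_on with
  | zero => simp
  | tmul b m => exact H b m
  | add x y hx hy => simp only [map_add, hx, hy]

end NCExtendScalars

/-- The functor `B ⊗_A - : Mod A ⥤ Mod B` on left modules, for a ring homomorphism `A → B`. -/
def ncExtendScalars {A B : Type u} [Ring A] [Ring B] (f : A →+* B) :
    ModuleCat.{u} A ⥤ ModuleCat.{u} B where
  obj M := ModuleCat.of B ((B ⊗[ℤ] M) ⧸ NCExtendScalars.relations f M)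
  map g := ModuleCat.ofHom (NCExtendScalars.mapLinear f g.hom)
  map_id M := ModuleCat.hom_ext (NCExtendScalars.hom_ext f fun b m => by simp)
  map_comp g h := ModuleCat.hom_ext (NCExtendScalars.hom_ext f fun b m => by simp)

instance {A B : Type u} [Ring A] [Ring B] (f : A →+* B) : (ncExtendScalars f).Additive where
  map_add {M N g h} := ModuleCat.hom_ext (NCExtendScalars.hom_ext f fun b m => by
    change (NCExtendScalars.relations f N).mkQ (b ⊗ₜ[ℤ] (g.hom m + h.hom m)) =
      (NCExtendScalars.relations f N).mkQ (b ⊗ₜ[ℤ] g.hom m) +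
        (NCExtendScalars.relations f N).mkQ (b ⊗ₜ[ℤ] h.hom m)
    rw [TensorProduct.tmul_add, map_add])

/-! ### The left derived functor on the bounded above derived category -/

section LeftDerived

variable {C : Type*} [Category* C] [Abelian C] [HasDerivedCategory C]

variable (C) in
/-- The bounded above derived category `D⁻(C)`, as a full subcategory of `D(C)`. -/
abbrev DMinus := (DerivedCategory.TStructure.t (C := C)).minus.FullSubcategory

/-- A projective resolution of an object `X` of `D(C)`: a bounded above complex of projective
objects together with an isomorphism to `X` in `D(C)`. -/
structure ProjRes (X : DerivedCategory C) where
  cx : CochainComplex C ℤ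
  bounded : ∃ n : ℤ, cx.IsStrictlyLE n
  projective : ∀ i : ℤ, Projective (cx.X i)
  iso : DerivedCategory.Qh.obj ((HomotopyCategory.quotient C (.up ℤ)).obj cx) ≅ X

theorem ProjRes.isKProjective {X : DerivedCategory C} (P : ProjRes X) : P.cx.IsKProjective := by
  obtain ⟨n, hn⟩ := P.bounded
  have := P.projective
  exact CochainComplex.isKProjective_of_projective P.cx n

theorem quasiIso_of_op {C : Type*} [Category* C] [Abelian C] {K L : CochainComplex C ℤ}
    (g : K ⟶ L) (hg : QuasiIso ((CochainComplex.opEquivalence C).functor.map g.op)) :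
    QuasiIso g := by
  rw [quasiIso_iff] at hg ⊢
  intro n
  have h := hg (-n)
  rw [quasiIsoAt_iff' _ (-n - 1) (-n) (-n + 1) (by simp) (by simp)] at h
  have h2 : ShortComplex.QuasiIso
      (ShortComplex.opMap ((HomologicalComplex.shortComplexFunctor' C (.up ℤ)
        (-(-n + 1)) (- -n) (-(-n - 1))).map g)) := h
  rw [ShortComplex.quasiIso_opMap_iff] at h2
  have h3 : QuasiIsoAt g (- -n) := by
    rwa [quasiIsoAt_iff' _ (-(-n + 1)) (- -n) (-(-n - 1)) (by simp; ring) (by simp; ring)]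
  rwa [neg_neg] at h3

theorem exists_quasiIso_projective {C : Type*} [Category* C] [Abelian C] [EnoughProjectives C]
    (K : CochainComplex C ℤ) (n : ℤ) [K.IsStrictlyLE n] :
    ∃ (P : CochainComplex C ℤ) (p : P ⟶ K), QuasiIso p ∧ (∀ i, Projective (P.X i)) ∧
      P.IsStrictlyLE n := by
  let e := CochainComplex.opEquivalence C
  have : CochainComplex.IsStrictlyGE (e.functor.obj (Opposite.op K)) (-n) := by
    rw [CochainComplex.isStrictlyGE_iff]
    intro i hi
    exact (K.isZero_of_isStrictlyLE n (-i) (by lia)).op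
  obtain ⟨I, i, hi, hI, hIn⟩ :=
    CochainComplex.Plus.modelCategoryQuillen.exists_quasiIso_injective
      (e.functor.obj (Opposite.op K)) (-n)
  refine ⟨(e.inverse.obj I).unop, (e.unit.app _ ≫ e.inverse.map i).unop, ?_, ?_, ?_⟩
  · apply quasiIso_of_op
    have h : e.functor.map (e.unit.app (Opposite.op K) ≫ e.inverse.map i) =
        i ≫ e.counitInv.app I := by
      simp
    change QuasiIso (e.functor.map (e.unit.app (Opposite.op K) ≫ e.inverse.map i))
    rw [h]
    infer_instance
  · intro j
    have := hI (-j)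
    exact inferInstanceAs (Projective (I.X (-j)).unop)
  · rw [CochainComplex.isStrictlyLE_iff]
    intro j hj
    exact (I.isZero_of_isStrictlyGE (-n) (-j) (by lia)).unop
theorem ProjRes.nonempty [EnoughProjectives C] (X : DMinus C) : Nonempty (ProjRes X.obj) := by
  obtain ⟨X, n, hX⟩ := X
  have : X.IsLE n := hX
  obtain ⟨K, _, ⟨e⟩⟩ := DerivedCategory.exists_iso_Q_obj_of_isLE X n
  obtain ⟨P, p, hp, hP, hn⟩ := exists_quasiIso_projective K n
  exact ⟨P, ⟨n, hn⟩, hP, (DerivedCategory.quotientCompQhIso C).app P ≪≫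
    asIso (DerivedCategory.Q.map p) ≪≫ e.symm⟩

/-- A chosen projective resolution of an object of `D⁻(C)`. -/
def projRes [EnoughProjectives C] (X : DMinus C) : ProjRes X.obj := (ProjRes.nonempty X).some

/-- The chosen projective resolution, as an object of the homotopy category. -/
abbrev projResObj [EnoughProjectives C] (X : DMinus C) : HomotopyCategory C (.up ℤ) :=
  (HomotopyCategory.quotient C (.up ℤ)).obj (projRes X).cx

theorem projRes_existsUnique [EnoughProjectives C] {X Y : DMinus C} (φ : X ⟶ Y) :
    ∃! ψ : projResObj X ⟶ projResObj Y,
      DerivedCategory.Qh.map ψ ≫ (projRes Y).iso.hom = (projRes X).iso.hom ≫ φ.hom := by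
  have := (projRes X).isKProjective
  obtain ⟨ψ, h₁, h₂⟩ :=
    (CochainComplex.IsKProjective.Qh_map_bijective (projRes X).cx (projResObj Y)).existsUnique
      ((projRes X).iso.hom ≫ φ.hom ≫ (projRes Y).iso.inv)
  refine ⟨ψ, by simp [h₁], fun ψ' h => h₂ ψ' ?_⟩
  have h' : DerivedCategory.Qh.map ψ' ≫ (projRes Y).iso.hom = (projRes X).iso.hom ≫ φ.hom := h
  change DerivedCategory.Qh.map ψ' = (projRes X).iso.hom ≫ φ.hom ≫ (projRes Y).iso.inv
  rw [← Category.assoc, ← h', Category.assoc, Iso.hom_inv_id, Category.comp_id]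

/-- The unique homotopy class of maps between the chosen projective resolutions
that lifts a morphism of `D⁻(C)`. -/
def projResMap [EnoughProjectives C] {X Y : DMinus C} (φ : X ⟶ Y) :
    projResObj X ⟶ projResObj Y :=
  (projRes_existsUnique φ).choose

theorem projResMap_comm [EnoughProjectives C] {X Y : DMinus C} (φ : X ⟶ Y) :
    DerivedCategory.Qh.map (projResMap φ) ≫ (projRes Y).iso.hom =
      (projRes X).iso.hom ≫ φ.hom :=
  (projRes_existsUnique φ).choose_spec.1

theorem projResMap_unique [EnoughProjectives C] {X Y : DMinus C} (φ : X ⟶ Y)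
    (ψ : projResObj X ⟶ projResObj Y)
    (h : DerivedCategory.Qh.map ψ ≫ (projRes Y).iso.hom = (projRes X).iso.hom ≫ φ.hom) :
    ψ = projResMap φ :=
  (projRes_existsUnique φ).unique h (projResMap_comm φ)

/-- Taking projective resolutions, as a functor from `D⁻(C)` to the homotopy category. -/
def projResFunctor (C : Type*) [Category* C] [Abelian C] [HasDerivedCategory C]
    [EnoughProjectives C] : DMinus C ⥤ HomotopyCategory C (.up ℤ) where
  obj X := projResObj X
  map φ := projResMap φ
  map_id X := (projResMap_unique _ _ (by simp)).symm
  map_comp φ ψ := (projResMap_unique _ _ (by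
    rw [Functor.map_comp, Category.assoc, projResMap_comm, ← Category.assoc, projResMap_comm]
    simp)).symm

/-- The left derived functor `D⁻(C) ⥤ D(D')` of an additive functor `T : C ⥤ D'`: resolve by a
bounded above complex of projective objects and apply `T` in each degree. -/
def leftDerivedMinus {D' : Type*} [Category* D'] [Abelian D'] [HasDerivedCategory D']
    [EnoughProjectives C] (T : C ⥤ D') [T.Additive] : DMinus C ⥤ DerivedCategory D' :=
  projResFunctor C ⋙ T.mapHomotopyCategory (.up ℤ) ⋙ DerivedCategory.Qh

end LeftDerived

/-! ### Complexes of modules -/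

section Modules

variable {A : Type u} [Ring A] [HasDerivedCategory.{w} (ModuleCat.{u} A)]

variable (A) in
/-- The objects of `D(A)` that belong to `D⁻(mod A)`: those represented by a bounded above
complex of finitely generated modules. -/
def dMinusMod : ObjectProperty (DerivedCategory (ModuleCat.{u} A)) := fun X =>
  ∃ K : CochainComplex (ModuleCat.{u} A) ℤ,
    (∀ i : ℤ, Module.Finite A (K.X i)) ∧ (∃ n : ℤ, K.IsStrictlyLE n) ∧
      Nonempty (X ≅ DerivedCategory.Q.obj K)

/-- Perfect complexes: the objects of `D(A)` represented by a bounded complex of finitely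
generated projective modules. -/
def IsPerfect (X : DerivedCategory (ModuleCat.{u} A)) : Prop :=
  ∃ K : CochainComplex (ModuleCat.{u} A) ℤ,
    (∀ i : ℤ, Module.Finite A (K.X i) ∧ Module.Projective A (K.X i)) ∧
      (∃ a : ℤ, K.IsStrictlyGE a) ∧ (∃ b : ℤ, K.IsStrictlyLE b) ∧
      Nonempty (X ≅ DerivedCategory.Q.obj K)

/-- The relation `X ≥ Y`: `Hom(X, Y[i]) = 0` for all `i > 0`. -/
def SiltGE (X Y : DerivedCategory (ModuleCat.{u} A)) : Prop :=
  ∀ i : ℤ, 0 < i → ∀ φ : X ⟶ Y⟦i⟧, φ = 0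

/-- The relation `X ⊥ Y`: `Hom(X, Y[i]) = 0` for all `i`. -/
def SiltPerp (X Y : DerivedCategory (ModuleCat.{u} A)) : Prop :=
  ∀ i : ℤ, ∀ φ : X ⟶ Y⟦i⟧, φ = 0

/-- A presilting complex is a perfect complex `X` with `X ≥ X`. -/
def IsPresilting (X : DerivedCategory (ModuleCat.{u} A)) : Prop :=
  IsPerfect X ∧ SiltGE X X

theorem dMinusMod_le_minus :
    dMinusMod A ≤ (DerivedCategory.TStructure.t (C := ModuleCat.{u} A)).minus := by
  rintro X ⟨K, -, ⟨n, _⟩, ⟨e⟩⟩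
  have : DerivedCategory.IsLE (DerivedCategory.Q.obj K) n := inferInstance
  exact ⟨n, DerivedCategory.TStructure.t.isLE_of_iso e.symm n⟩

variable (A) in
/-- The category `D⁻(mod A)`, as a full subcategory of `D(A)`. -/
abbrev DMinusMod := (dMinusMod (A := A)).FullSubcategory

end Modules

/-- The category of modules over an algebra over a commutative ring `k` is `k`-linear. -/
instance (priority := 50) moduleCatLinearOfAlgebra {k A : Type u} [CommRing k] [Ring A] [Algebra k A] :
    Linear k (ModuleCat.{u} A) :=
  letI (M : ModuleCat.{u} A) : Module k M := Module.restrictScalars k A M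
  haveI (M : ModuleCat.{u} A) : IsScalarTower k A M := IsScalarTower.restrictScalars k A M
  { homModule := fun _ _ => inferInstance }

/-! ### Reduction of an algebra modulo an ideal of the base ring -/

section Reduction

variable {R : Type u} [CommRing R] (Λ : Type u) [Ring Λ] [Algebra R Λ] (𝔞 : Ideal R)

/-- The ideal `𝔞Λ` of an `R`-algebra `Λ`. -/
abbrev extIdeal : Ideal Λ := 𝔞.map (algebraMap R Λ)

instance extIdeal_isTwoSided : (extIdeal Λ 𝔞).IsTwoSided where
  mul_mem_of_left {x} b hx := by
    induction hx using Submodule.span_induction with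
    | mem x hx =>
      obtain ⟨r, hr, rfl⟩ := hx
      rw [Algebra.commutes]
      exact Ideal.mul_mem_left _ _ (Ideal.mem_map_of_mem _ hr)
    | zero => simp
    | add x y _ _ hx hy => rw [add_mul]; exact add_mem hx hy
    | smul a x _ hx => rw [smul_eq_mul, mul_assoc]; exact Ideal.mul_mem_left _ _ hx

/-- The quotient `Λ̄ = Λ/𝔞Λ`. -/
abbrev RedAlg : Type u := Λ ⧸ extIdeal Λ 𝔞

instance redAlgAlgebra : Algebra (R ⧸ 𝔞) (RedAlg Λ 𝔞) :=
  Ideal.Quotient.algebraQuotientOfLEComap Ideal.le_comap_map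

/-- The reduction functor `D⁻(mod Λ) ⥤ D(Λ̄)`, `M ↦ M ⊗ᴸ_Λ Λ̄`. Right modules over a ring are
left modules over the opposite ring, and `M ⊗_Λ Λ̄ = Λ̄ᵐᵒᵖ ⊗_{Λᵐᵒᵖ} M`. -/
def reduction [HasDerivedCategory.{w} (ModuleCat.{u} Λᵐᵒᵖ)]
    [HasDerivedCategory.{w'} (ModuleCat.{u} (RedAlg Λ 𝔞)ᵐᵒᵖ)] :
    DMinusMod Λᵐᵒᵖ ⥤ DerivedCategory (ModuleCat.{u} (RedAlg Λ 𝔞)ᵐᵒᵖ) :=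
  ObjectProperty.ιOfLE dMinusMod_le_minus ⋙
    leftDerivedMinus (ncExtendScalars (Ideal.Quotient.mk (extIdeal Λ 𝔞)).op)

end Reduction

end

/-! Represent `L` by a bounded complex `P` of finitely generated projectives and `M` by a bounded
above complex `Q` of projectives. Everything is then a statement about one complex of `R`-modules,
`C = Hom(P, Q)`, whose cohomology is `Hom(L, M[i])`. It is bounded above. Each term is a finite
product of groups `Hom(P^p, Q^q)`, which are retracts of direct sums of copies of the algebra, hence
Tor-independent of `R ⧸ 𝔞`. Moreover `C / 𝔞C` is the complex of homomorphisms between the reductions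
of `P` and `Q` (`isReduction_cochain`).

Suppose `H^i(C) = 0` for `i > m`. Descending from the zero terms at the top along `0 → Z^i → C^i →
Z^{i+1} → 0`, the cocycle modules `Z^i` with `i > m` are Tor-independent, so `Z^m ∩ 𝔞C^m = 𝔞Z^m`
(`IsReduction.ker_inf_smul_top_le`). Hence the cohomology of `C / 𝔞C` also vanishes above `m`,
cocycles of degree `m` lift (`exists_cocycle`), and the kernel of `H^m(C) → H^m(C / 𝔞C)` is
`𝔞H^m(C)` (`mem_of_π_eq`). If the reduction also has no cohomology in degree `m`, then `H^m(C) =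
𝔞H^m(C)`. This module is finitely generated because `M` is represented by a complex of finitely
generated modules, so Nakayama's lemma kills it; descending induction gives the converse vanishing
(`exactAbove_of_reduction`).

The case `m = 0` gives fullness and the description of the endomorphism algebra; letting `m` vary
gives the statement on `⊥`. -/

/-! ### Modules that are Tor-independent of a given module -/

section TorIndependent

variable {R : Type u} [CommRing R] {Y : ModuleCat.{u} R}

/-- A module `N` such that `N ⊗ F` is exact in positive degrees, for the given projective
resolution `F` of `Y`, i.e. such that `Tor_n(N, Y) = 0` for all `n > 0`. -/
def TorIndependent (F : ProjectiveResolution Y) (N : Type*) [AddCommGroup N] [Module R N] : Prop :=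
  ∀ n, Function.Exact (LinearMap.lTensor N (F.complex.d (n + 2) (n + 1)).hom)
    (LinearMap.lTensor N (F.complex.d (n + 1) n).hom)

instance projectiveResolution_projective (F : ProjectiveResolution Y) (n : ℕ) :
    Module.Projective R (F.complex.X n) :=
  (IsProjective.iff_projective _).2 (F.projective n)

/-- The augmentation of a projective resolution of a module, as a linear map. -/
noncomputable def CategoryTheory.ProjectiveResolution.augmentation (F : ProjectiveResolution Y) :
    F.complex.X 0 →ₗ[R] Y :=
  (F.π.f 0).hom

theorem CategoryTheory.ProjectiveResolution.exact_d_augmentation (F : ProjectiveResolution Y) :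
    Function.Exact (F.complex.d 1 0).hom F.augmentation :=
  (ShortComplex.ShortExact.moduleCat_exact_iff_function_exact _).1 F.exact₀

theorem CategoryTheory.ProjectiveResolution.augmentation_surjective (F : ProjectiveResolution Y) :
    Function.Surjective F.augmentation :=
  (ModuleCat.epi_iff_surjective _).1 inferInstance

theorem CategoryTheory.ProjectiveResolution.rTensor_lTensor_d (F : ProjectiveResolution Y)
    {M M' : Type*} [AddCommGroup M] [Module R M] [AddCommGroup M'] [Module R M']
    (g : M →ₗ[R] M') (m n : ℕ)
    (y : M ⊗[R] F.complex.X m) :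
    LinearMap.rTensor _ g (LinearMap.lTensor M (F.complex.d m n).hom y) =
      LinearMap.lTensor M' (F.complex.d m n).hom (LinearMap.rTensor _ g y) := by
  rw [← LinearMap.comp_apply, ← LinearMap.comp_apply, LinearMap.rTensor_comp_lTensor,
    LinearMap.lTensor_comp_rTensor]

theorem CategoryTheory.ProjectiveResolution.lTensor_d_d (F : ProjectiveResolution Y) (M : Type*)
    [AddCommGroup M] [Module R M] (n : ℕ) (y : M ⊗[R] F.complex.X (n + 2)) :
    LinearMap.lTensor M (F.complex.d (n + 1) n).hom
      (LinearMap.lTensor M (F.complex.d (n + 2) (n + 1)).hom y) = 0 := by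
  rw [← LinearMap.comp_apply, ← LinearMap.lTensor_comp, ← ModuleCat.hom_comp, F.complex.d_comp_d,
    ModuleCat.hom_zero, LinearMap.lTensor_zero, LinearMap.zero_apply]

/-- Tor is the left derived functor of `N ⊗ -`, which any projective resolution computes; vanishing
homology in degree `n + 1` is exactness there. -/
theorem torIndependent_of_isZero_tor (F : ProjectiveResolution Y) (N : Type u) [AddCommGroup N]
    [Module R N]
    (h : ∀ n : ℕ, 0 < n → IsZero (((Tor (ModuleCat.{u} R) n).obj (ModuleCat.of R N)).obj Y)) :
    TorIndependent F N := by
  intro n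
  let G := (MonoidalCategory.tensoringLeft (ModuleCat.{u} R)).obj (ModuleCat.of R N)
  have h1 := (h (n + 1) n.succ_pos).of_iso (F.isoLeftDerivedObj G (n + 1)).symm
  have h2 : ((G.mapHomologicalComplex _).obj F.complex).ExactAt (n + 1) :=
    (HomologicalComplex.exactAt_iff_isZero_homology _ _).2 h1
  rw [HomologicalComplex.exactAt_iff' _ (n + 2) (n + 1) n (by simp) (by simp)] at h2
  exact (ShortComplex.ShortExact.moduleCat_exact_iff_function_exact _).1 h2

namespace TorIndependent

variable {F : ProjectiveResolution Y}
variable {N N' : Type*} [AddCommGroup N] [Module R N] [AddCommGroup N'] [Module R N']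

theorem of_retract (h : TorIndependent F N) (i : N' →ₗ[R] N) (p : N →ₗ[R] N')
    (hp : p ∘ₗ i = LinearMap.id) : TorIndependent F N' := by
  intro n x
  have key : ∀ (n : ℕ) (y : N' ⊗[R] F.complex.X n),
      LinearMap.rTensor _ p (LinearMap.rTensor _ i y) = y := fun n y => by
    rw [← LinearMap.comp_apply, ← LinearMap.rTensor_comp, hp, LinearMap.rTensor_id,
      LinearMap.id_apply]
  constructor
  · intro hx
    obtain ⟨y, hy⟩ := (h n (LinearMap.rTensor _ i x)).1 (by
      rw [← F.rTensor_lTensor_d, hx, map_zero])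
    exact ⟨LinearMap.rTensor _ p y, by rw [← F.rTensor_lTensor_d, hy, key]⟩
  · rintro ⟨y, rfl⟩
    exact F.lTensor_d_d _ n y

theorem of_linearEquiv (h : TorIndependent F N) (e : N ≃ₗ[R] N') : TorIndependent F N' :=
  h.of_retract e.symm.toLinearMap e.toLinearMap (by simp)

theorem finsupp (h : TorIndependent F N) (ι : Type*) : TorIndependent F (ι →₀ N) := by
  classical
  intro n
  have hsq : ∀ m n : ℕ, (TensorProduct.finsuppLeft R R N (F.complex.X n) ι).toLinearMap ∘ₗ
      LinearMap.lTensor (ι →₀ N) (F.complex.d m n).hom =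
      Finsupp.mapRange.linearMap (LinearMap.lTensor N (F.complex.d m n).hom) ∘ₗ
      (TensorProduct.finsuppLeft R R N (F.complex.X m) ι).toLinearMap := by
    intro m n
    ext i x y j
    simp [TensorProduct.finsuppLeft_apply_tmul_apply, Finsupp.single_apply]
  have hsq' : ∀ (m n : ℕ) x, TensorProduct.finsuppLeft R R N (F.complex.X n) ι
      (LinearMap.lTensor (ι →₀ N) (F.complex.d m n).hom x) =
      Finsupp.mapRange.linearMap (LinearMap.lTensor N (F.complex.d m n).hom)
      (TensorProduct.finsuppLeft R R N (F.complex.X m) ι x) := fun m n x =>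
    LinearMap.congr_fun (hsq m n) x
  intro x
  constructor
  · intro hx
    have h1 := hsq' (n + 1) n x
    rw [hx, map_zero] at h1
    have h2 : ∀ i, ∃ y, LinearMap.lTensor N (F.complex.d (n + 2) (n + 1)).hom y =
        TensorProduct.finsuppLeft R R N (F.complex.X (n + 1)) ι x i := fun i =>
      (h n _).1 (by simpa using (DFunLike.congr_fun h1 i).symm)
    choose g hg using h2
    let z := TensorProduct.finsuppLeft R R N (F.complex.X (n + 1)) ι x
    -- The chosen preimages `g i` may be nonzero where `z` vanishes; cutting them off to the support
    -- of `z` makes the family finitely supported.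
    refine ⟨(TensorProduct.finsuppLeft R R N (F.complex.X (n + 2)) ι).symm
      (Finsupp.onFinset z.support (fun i => if i ∈ z.support then g i else 0)
        (fun i hi => by by_contra h; simp [h] at hi)), ?_⟩
    apply (TensorProduct.finsuppLeft R R N (F.complex.X (n + 1)) ι).injective
    rw [hsq', LinearEquiv.apply_symm_apply]
    ext1 i
    simp only [Finsupp.mapRange.linearMap_apply, Finsupp.mapRange_apply, Finsupp.onFinset_apply]
    split_ifs with hi
    · exact hg i
    · rw [map_zero]
      exact (Finsupp.notMem_support_iff.1 hi).symm
  · rintro ⟨y, rfl⟩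
    exact F.lTensor_d_d _ n y

theorem pi {ι : Type*} [Finite ι] {M : ι → Type*} [∀ i, AddCommGroup (M i)]
    [∀ i, Module R (M i)] (h : ∀ i, TorIndependent F (M i)) : TorIndependent F (∀ i, M i) := by
  classical
  have := Fintype.ofFinite ι
  intro n x
  constructor
  · intro hx
    have h2 : ∀ i, ∃ y, LinearMap.lTensor (M i) (F.complex.d (n + 2) (n + 1)).hom y =
        LinearMap.rTensor _ (LinearMap.proj i) x := fun i =>
      (h i n _).1 (by rw [← F.rTensor_lTensor_d, hx, map_zero])
    choose g hg using h2
    refine ⟨∑ i, LinearMap.rTensor _ (LinearMap.single R M i) (g i), ?_⟩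
    rw [map_sum]
    simp_rw [← F.rTensor_lTensor_d, hg, ← LinearMap.comp_apply, ← LinearMap.rTensor_comp]
    rw [← LinearMap.sum_apply, ← LinearMap.coe_rTensorHom]
    rw [← map_sum]
    have : ∑ i, LinearMap.single R M i ∘ₗ LinearMap.proj i = LinearMap.id := by
      ext v j
      simp
    rw [this]
    simp
  · rintro ⟨y, rfl⟩
    exact F.lTensor_d_d _ n y

section Exact

variable {N'' : Type*} [AddCommGroup N''] [Module R N''] {i : N' →ₗ[R] N} {p : N →ₗ[R] N''}

/-- The diagram chase underlying the long exact sequence of Tor. -/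
theorem exists_lTensor_eq (h'' : TorIndependent F N'') (hi : Function.Injective i)
    (hp : Function.Surjective p) (hip : Function.Exact i p) {n : ℕ}
    (x : N' ⊗[R] F.complex.X n) (y : N ⊗[R] F.complex.X (n + 1))
    (hy : LinearMap.lTensor N (F.complex.d (n + 1) n).hom y = LinearMap.rTensor _ i x) :
    ∃ z, LinearMap.lTensor N' (F.complex.d (n + 1) n).hom z = x := by
  have hpy : LinearMap.lTensor N'' (F.complex.d (n + 1) n).hom (LinearMap.rTensor _ p y) = 0 := by
    rw [← F.rTensor_lTensor_d, hy, ← LinearMap.comp_apply, ← LinearMap.rTensor_comp,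
      hip.linearMap_comp_eq_zero, LinearMap.rTensor_zero, LinearMap.zero_apply]
  obtain ⟨w, hw⟩ := (h'' n _).1 hpy
  obtain ⟨w, rfl⟩ := LinearMap.rTensor_surjective _ hp w
  rw [← F.rTensor_lTensor_d, ← sub_eq_zero, ← map_sub] at hw
  obtain ⟨z, hz⟩ := (rTensor_exact (F.complex.X (n + 1)) hip hp _).1 hw
  -- The terms of `F` are flat, so the equation may be checked in `N`. There `-z` becomes `y` minus
  -- a boundary, which has the same differential as `y`.
  refine ⟨-z, Module.Flat.rTensor_preserves_injective_linearMap i hi ?_⟩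
  rw [F.rTensor_lTensor_d, map_neg, hz, map_neg, map_sub, F.lTensor_d_d, hy]
  abel

/-- In the long exact sequence, `Tor_n(N')` lies between `Tor_{n+1}(N'')` and `Tor_n(N)`. -/
theorem of_exact (h : TorIndependent F N) (h'' : TorIndependent F N'') (hi : Function.Injective i)
    (hp : Function.Surjective p) (hip : Function.Exact i p) : TorIndependent F N' := by
  intro n x
  constructor
  · intro hx
    obtain ⟨y, hy⟩ := (h n (LinearMap.rTensor _ i x)).1
      (by rw [← F.rTensor_lTensor_d, hx, map_zero])
    exact h''.exists_lTensor_eq hi hp hip x y hy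
  · rintro ⟨y, rfl⟩
    exact F.lTensor_d_d _ n y

/-- The kernel is a quotient of `Tor_1(N'', Y)`; the chase is the same, with an element of `N' ⊗ Y`
lifted along the augmentation. -/
theorem rTensor_injective (h'' : TorIndependent F N'') (hi : Function.Injective i)
    (hp : Function.Surjective p) (hip : Function.Exact i p) :
    Function.Injective (LinearMap.rTensor Y i) := by
  rw [injective_iff_map_eq_zero]
  intro x hx
  obtain ⟨x, rfl⟩ := LinearMap.lTensor_surjective N' F.augmentation_surjective x
  have h1 : LinearMap.lTensor N F.augmentation (LinearMap.rTensor _ i x) = 0 := by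
    rw [← hx, ← LinearMap.comp_apply, ← LinearMap.comp_apply, LinearMap.rTensor_comp_lTensor,
      LinearMap.lTensor_comp_rTensor]
  obtain ⟨y, hy⟩ := (lTensor_exact N F.exact_d_augmentation F.augmentation_surjective _).1 h1
  obtain ⟨z, rfl⟩ := h''.exists_lTensor_eq hi hp hip x y hy
  exact (lTensor_exact N' F.exact_d_augmentation F.augmentation_surjective _).2 ⟨z, rfl⟩

theorem ker {f : N →ₗ[R] N'} (h : TorIndependent F N) (h' : TorIndependent F N')
    (hf : Function.Surjective f) : TorIndependent F f.ker :=
  h.of_exact h' f.ker.injective_subtype hf (LinearMap.exact_subtype_ker_map f)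

end Exact

/-- Since `Tor_1(N', R ⧸ 𝔞) = 0`, tensoring with `R ⧸ 𝔞` keeps `ker f → N` injective, and `X ⊗ R ⧸
𝔞` is `X / 𝔞X`. -/
theorem ker_inf_smul_top_le {𝔞 : Ideal R} {F : ProjectiveResolution (ModuleCat.of R (R ⧸ 𝔞))}
    {f : N →ₗ[R] N'} (h' : TorIndependent F N') (hf : Function.Surjective f) :
    f.ker ⊓ 𝔞 • ⊤ ≤ 𝔞 • f.ker := by
  rintro x ⟨hx, hx'⟩
  have h1 := h'.rTensor_injective f.ker.injective_subtype hf (LinearMap.exact_subtype_ker_map f)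
  have h2 : (⟨x, hx⟩ : f.ker) ⊗ₜ[R] (Ideal.Quotient.mk 𝔞 1) = 0 := by
    apply h1
    rw [map_zero]
    apply (TensorProduct.tensorQuotEquivQuotSMul N 𝔞).injective
    rw [map_zero]
    change TensorProduct.tensorQuotEquivQuotSMul N 𝔞 (x ⊗ₜ[R] Ideal.Quotient.mk 𝔞 1) = 0
    rwa [TensorProduct.tensorQuotEquivQuotSMul_tmul_mk, one_smul,
      Submodule.Quotient.mk_eq_zero]
  have h3 : (⟨x, hx⟩ : f.ker) ∈ 𝔞 • (⊤ : Submodule R f.ker) := by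
    have := congrArg (TensorProduct.tensorQuotEquivQuotSMul f.ker 𝔞) h2
    rwa [TensorProduct.tensorQuotEquivQuotSMul_tmul_mk, one_smul, map_zero,
      Submodule.Quotient.mk_eq_zero] at this
  have h4 := Submodule.mem_map_of_mem (f := f.ker.subtype) h3
  rwa [Submodule.map_smul'', Submodule.map_top, Submodule.range_subtype] at h4

end TorIndependent

end TorIndependent

/-! ### Reduction of complexes with Tor-independent terms -/

section ReductionOfComplexes

theorem TorIndependent.of_subsingleton {R : Type u} [CommRing R] {Y : ModuleCat.{u} R}
    (F : ProjectiveResolution Y) (N : Type*) [AddCommGroup N] [Module R N] [Subsingleton N] :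
    TorIndependent F N := fun _ _ =>
  ⟨fun _ => ⟨0, Subsingleton.elim _ _⟩, fun _ => Subsingleton.elim _ _⟩

variable {R : Type u} [CommRing R] {𝔞 : Ideal R}

/-- A bounded above complex `C` of `R`-modules which are Tor-independent of `R ⧸ 𝔞`,
together with a map `π` to a complex `D` that identifies `D` with `C / 𝔞 C`. -/
structure IsReduction (F : ProjectiveResolution (ModuleCat.of R (R ⧸ 𝔞)))
    {C D : ℤ → Type*} [∀ i, AddCommGroup (C i)] [∀ i, Module R (C i)] [∀ i, AddCommGroup (D i)]
    (d : ∀ i, C i →ₗ[R] C (i + 1)) (d' : ∀ i, D i →+ D (i + 1)) (π : ∀ i, C i →+ D i) : Prop where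
  d_d : ∀ i x, d (i + 1) (d i x) = 0
  bounded : ∃ N, ∀ i, N < i → Subsingleton (C i)
  torIndependent : ∀ i, TorIndependent F (C i)
  surjective : ∀ i, Function.Surjective (π i)
  eq_zero_iff : ∀ i x, π i x = 0 ↔ x ∈ 𝔞 • (⊤ : Submodule R (C i))
  comm : ∀ i x, π (i + 1) (d i x) = d' i (π i x)

/-- Exactness at `j + 1` for all `j ≥ m`, of a sequence of homomorphisms. -/
def ExactAbove {C : ℤ → Type*} [∀ i, AddCommGroup (C i)] (d : ∀ i, C i →+ C (i + 1)) (m : ℤ) :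
    Prop :=
  ∀ j, m ≤ j → ∀ x, d (j + 1) x = 0 → ∃ y, d j y = x

namespace IsReduction

variable {F : ProjectiveResolution (ModuleCat.of R (R ⧸ 𝔞))}
  {C D : ℤ → Type*} [∀ i, AddCommGroup (C i)] [∀ i, Module R (C i)] [∀ i, AddCommGroup (D i)]
  {d : ∀ i, C i →ₗ[R] C (i + 1)} {d' : ∀ i, D i →+ D (i + 1)} {π : ∀ i, C i →+ D i} {m : ℤ}

/-- Descending induction from the zero terms: exactness makes `0 → Z^i → C^i → Z^{i+1} → 0` exact,
and `of_exact` passes from the last two terms to the first. -/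
theorem torIndependent_ker (h : IsReduction F d d' π)
    (hm : ExactAbove (fun i => (d i).toAddMonoidHom) m) {j : ℤ}
    (hj : m ≤ j) : TorIndependent F (d (j + 1)).ker := by
  obtain ⟨N, hN⟩ := h.bounded
  rcases le_or_gt N j with hNj | hNj
  · have := hN (j + 1) (by lia)
    exact .of_subsingleton F _
  induction j, hNj.le using Int.leInductionDown with
  | base => exact absurd hNj (lt_irrefl _)
  | pred n hn ih =>
    have key : TorIndependent F (d (n + 1)).ker := by
      rcases hn.lt_or_eq with hn | rfl
      · exact ih (by lia) hn
      · have := hN (n + 1) (by lia)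
        exact .of_subsingleton F _
    obtain ⟨n, rfl⟩ : ∃ k, n = k + 1 := ⟨n - 1, by lia⟩
    rw [add_sub_cancel_right] at hj ⊢
    have h1 := TorIndependent.ker
      (f := (d (n + 1)).codRestrict (d (n + 1 + 1)).ker fun x => h.d_d _ x)
      (h.torIndependent (n + 1)) key
      (fun ⟨x, hx⟩ => (hm (n + 1) (by lia) x hx).imp fun y hy => Subtype.ext hy)
    exact (LinearMap.ker_codRestrict (d (n + 1 + 1)).ker (d (n + 1)) fun x => h.d_d _ x) ▸ h1

theorem ker_inf_smul_top_le (h : IsReduction F d d' π)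
    (hm : ExactAbove (fun i => (d i).toAddMonoidHom) m) :
    (d m).ker ⊓ 𝔞 • ⊤ ≤ 𝔞 • (d m).ker := by
  have h1 := TorIndependent.ker_inf_smul_top_le
    (f := (d m).codRestrict (d (m + 1)).ker fun x => h.d_d _ x)
    (h.torIndependent_ker hm le_rfl)
    (fun ⟨x, hx⟩ => (hm m le_rfl x hx).imp fun y hy => Subtype.ext hy)
  exact (LinearMap.ker_codRestrict (d (m + 1)).ker (d m) fun x => h.d_d _ x) ▸ h1

/-- For any lift `x` of a cocycle, `d x` lies in `𝔞C^{m+1} ∩ Z^{m+1} = 𝔞Z^{m+1}`. Exactness at `m +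
1` turns this into `d(𝔞C^m)`, so `x` can be corrected by an element of `𝔞C^m`, which `π` does not
see. -/
theorem exists_cocycle (h : IsReduction F d d' π)
    (hm : ExactAbove (fun i => (d i).toAddMonoidHom) m) (y : D m)
    (hy : d' m y = 0) : ∃ z, d m z = 0 ∧ π m z = y := by
  obtain ⟨x, rfl⟩ := h.surjective m y
  rw [← h.comm, h.eq_zero_iff] at hy
  have h1 := h.ker_inf_smul_top_le (fun j hj => hm j (by lia)) ⟨h.d_d m x, hy⟩
  have h2 : 𝔞 • (d (m + 1)).ker ≤ (𝔞 • (⊤ : Submodule R (C m))).map (d m) := by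
    rw [Submodule.map_smul'']
    refine smul_mono_right 𝔞 fun z hz => ?_
    obtain ⟨w, hw⟩ := hm m le_rfl z hz
    exact ⟨w, trivial, hw⟩
  obtain ⟨w, hw, hwx⟩ := h2 h1
  refine ⟨x - w, by rw [map_sub, hwx, sub_self], ?_⟩
  rw [map_sub, (h.eq_zero_iff m w).2 hw, sub_zero]

theorem exactAbove (h : IsReduction F d d' π)
    (hm : ExactAbove (fun i => (d i).toAddMonoidHom) m) : ExactAbove d' m := by
  intro j hj y hy
  obtain ⟨z, hz, rfl⟩ := h.exists_cocycle (m := j + 1) (fun i hi => hm i (by lia)) y hy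
  obtain ⟨w, rfl⟩ := hm j hj z hz
  exact ⟨π j w, (h.comm j w).symm⟩

/-- Lifting `y` to `w`, the cocycle `z - d w` lies in `𝔞C^{m+1}`, hence in `𝔞Z^{m+1}`. Exactness is
needed only beyond degree `m + 1`, so in degree `m + 1` the cohomology may be nonzero. -/
theorem mem_of_π_eq (h : IsReduction F d d' π)
    (hm : ExactAbove (fun i => (d i).toAddMonoidHom) (m + 1)) (z : C (m + 1))
    (hz : d (m + 1) z = 0) (y : D m) (hy : d' m y = π (m + 1) z) :
    z ∈ (d m).range ⊔ 𝔞 • (d (m + 1)).ker := by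
  obtain ⟨w, rfl⟩ := h.surjective m y
  have h1 : z - d m w ∈ 𝔞 • (d (m + 1)).ker := by
    apply h.ker_inf_smul_top_le hm
    refine ⟨?_, ?_⟩
    · change d _ _ = 0
      rw [map_sub, hz, h.d_d, sub_zero]
    · change _ ∈ 𝔞 • (⊤ : Submodule R (C (m + 1)))
      rw [← h.eq_zero_iff, map_sub, ← hy, h.comm, sub_self]
  rw [← add_sub_cancel (d m w) z]
  exact Submodule.add_mem_sup ⟨w, rfl⟩ h1

/-- Nakayama's lemma for the cohomology of a complex and of its reduction. -/
theorem exactAbove_of_reduction (h : IsReduction F d d' π)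
    (h𝔞 : 𝔞 ≤ (⊥ : Ideal R).jacobson)
    (hfg : ∀ i, ∃ S : Submodule R (C (i + 1)), S.FG ∧ S ≤ (d (i + 1)).ker ∧
      (d (i + 1)).ker ≤ (d i).range ⊔ S) (hm : ExactAbove d' m) :
    ExactAbove (fun i => (d i).toAddMonoidHom) m := by
  obtain ⟨N, hN⟩ := h.bounded
  -- The descending induction starts at `max m N`, beyond which the complex is zero.
  suffices ∀ k, k ≤ max m N → m ≤ k → ExactAbove (fun i => (d i).toAddMonoidHom) k by
    rcases le_total m (max m N) with hm | hm
    · exact this m hm le_rfl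
    · exact this m (le_max_left _ _) le_rfl
  intro k hk
  induction k, hk using Int.leInductionDown with
  | base =>
    intro _ j hj x hx
    have := hN (j + 1) (by lia)
    exact ⟨0, Subsingleton.elim _ _⟩
  | pred n hn ih =>
    intro hmn
    obtain ⟨n, rfl⟩ : ∃ k, n = k + 1 := ⟨n - 1, by lia⟩
    rw [add_sub_cancel_right] at hmn ⊢
    specialize ih (by lia)
    intro j hj x hx
    rcases hj.lt_or_eq with hj | rfl
    · exact ih j hj x hx
    -- The cocycles themselves need not be finitely generated, only their classes. Nakayama's lemma
    -- is therefore applied to a finitely generated `S` representing all classes, through `S ≤ Z ≤ B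
    -- + 𝔞Z ≤ B + 𝔞S` with `B` the coboundaries.
    obtain ⟨S, hS, hSk, hkS⟩ := hfg n
    have h1 : (d (n + 1)).ker ≤ (d n).range ⊔ 𝔞 • (d (n + 1)).ker := by
      intro z hz
      obtain ⟨y, hy⟩ := hm n hmn (π (n + 1) z) (by
        rw [← h.comm, show d (n + 1) z = 0 from hz, map_zero])
      exact h.mem_of_π_eq ih z hz y hy
    have h2 : S ≤ (d n).range ⊔ 𝔞 • S := by
      refine hSk.trans (h1.trans (sup_le le_sup_left ?_))
      refine (smul_mono_right 𝔞 hkS).trans ?_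
      rw [Submodule.smul_sup]
      exact sup_le_sup_right Submodule.smul_le_right _
    have h3 : S ≤ (d n).range :=
      Submodule.le_of_le_smul_of_le_jacobson_bot hS h𝔞 h2
    exact (sup_le le_rfl h3) (hkS hx)

end IsReduction

end ReductionOfComplexes

/-! ### Homomorphisms out of finitely generated projective modules -/

section HomOfProjective

section

variable (R : Type*) [CommRing R] (A : Type*) [Ring A] [Algebra R A]
  {P : Type*} [AddCommGroup P] [Module A P] (Q : Type*) [AddCommGroup Q] [Module A Q]
  [Module R Q] [IsScalarTower R A Q]

/-- Evaluation of linear maps at a finite family of elements. -/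
def evalFamily {n : ℕ} (x : Fin n → P) : (P →ₗ[A] Q) →ₗ[R] (Fin n → Q) where
  toFun g i := g (x i)
  map_add' _ _ := rfl
  map_smul' _ _ := rfl

-- A finitely generated projective `P` is a retract of some `A^n`, so `Hom_A(P, Q)` is a retract of
-- `Hom_A(A^n, Q) = Q^n`, `R`-linearly.
variable (P) in
theorem exists_evalFamily_leftInverse [Module.Finite A P] [Module.Projective A P] :
    ∃ (n : ℕ) (x : Fin n → P) (Φ : (Fin n → Q) →ₗ[R] (P →ₗ[A] Q)),
      Φ ∘ₗ evalFamily R A Q x = LinearMap.id := by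
  obtain ⟨n, p, s, -, -, hps⟩ := Module.Finite.exists_comp_eq_id_of_projective A P
  let b := Pi.basisFun A (Fin n)
  refine ⟨n, fun i => p (b i), LinearMap.lcomp R Q s ∘ₗ (b.constr R).toLinearMap, ?_⟩
  ext g x
  have : b.constr R (fun i => g (p (b i))) = g ∘ₗ p := b.ext fun i => by simp
  change b.constr R (fun i => g (p (b i))) (s x) = g x
  rw [this]
  exact congrArg g (LinearMap.congr_fun hps x)

variable {R A Q}

theorem exists_evalFamily_injective [Module.Finite A P] :
    ∃ (n : ℕ) (x : Fin n → P), Function.Injective (evalFamily R A Q x) := by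
  obtain ⟨n, p, hp⟩ := Module.Finite.exists_fin' A P
  refine ⟨n, fun i => p (Pi.basisFun A (Fin n) i), fun g g' h => ?_⟩
  have : g ∘ₗ p = g' ∘ₗ p := (Pi.basisFun A (Fin n)).ext fun i => congrFun h i
  exact LinearMap.cancel_right hp |>.1 this

theorem mem_smul_top_pi {R : Type*} [CommRing R] {ι : Type*} [Finite ι] {M : ι → Type*}
    [∀ i, AddCommGroup (M i)] [∀ i, Module R (M i)] {I : Ideal R} {v : ∀ i, M i}
    (h : ∀ i, v i ∈ I • (⊤ : Submodule R (M i))) :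
    v ∈ I • (⊤ : Submodule R (∀ i, M i)) := by
  classical
  have := Fintype.ofFinite ι
  rw [← Finset.univ_sum_single v]
  refine Submodule.sum_mem _ fun i _ => ?_
  have h1 := Submodule.mem_map_of_mem (f := LinearMap.single R M i) (h i)
  rw [Submodule.map_smul''] at h1
  exact Submodule.smul_mono le_rfl le_top h1

/-- The claim is clear for `Q^n`, a finite product, and passes to its retract `Hom_A(P, Q)`. -/
theorem linearMap_mem_smul_top [Module.Finite A P] [Module.Projective A P] {I : Ideal R}
    {g : P →ₗ[A] Q} (h : ∀ x, g x ∈ I • (⊤ : Submodule R Q)) :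
    g ∈ I • (⊤ : Submodule R (P →ₗ[A] Q)) := by
  obtain ⟨n, x, Φ, hΦ⟩ := exists_evalFamily_leftInverse R A P Q
  have h1 : evalFamily R A Q x g ∈ I • (⊤ : Submodule R (Fin n → Q)) :=
    mem_smul_top_pi fun i => h (x i)
  have h2 := Submodule.mem_map_of_mem (f := Φ) h1
  rw [Submodule.map_smul'', ← LinearMap.comp_apply, hΦ] at h2
  exact Submodule.smul_mono le_rfl le_top h2

theorem linearMap_finite [IsNoetherianRing R] [Module.Finite R Q] [Module.Finite A P] :
    Module.Finite R (P →ₗ[A] Q) := by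
  obtain ⟨n, x, hx⟩ := exists_evalFamily_injective (R := R) (A := A) (P := P) (Q := Q)
  exact Module.Finite.of_injective _ hx

end

/-- `Hom_A(P, Q)` is a retract of `Q^n`, and `Q` of a free module. `Q` may be infinitely generated,
as terms of an arbitrary projective resolution are, so infinite direct sums of `A` intervene. -/
theorem torIndependent_linearMap {R : Type u} [CommRing R] {Y : ModuleCat.{u} R}
    {F : ProjectiveResolution Y} {A : Type*} [Ring A] [Algebra R A] (hA : TorIndependent F A)
    (P : Type*) [AddCommGroup P] [Module A P] [Module.Finite A P] [Module.Projective A P]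
    (Q : Type*) [AddCommGroup Q] [Module A Q] [Module R Q] [IsScalarTower R A Q]
    [Module.Projective A Q] : TorIndependent F (P →ₗ[A] Q) := by
  obtain ⟨n, x, Φ, hΦ⟩ := exists_evalFamily_leftInverse R A P Q
  refine TorIndependent.of_retract (N := Fin n → Q) (.pi fun _ => ?_) _ Φ hΦ
  obtain ⟨s, hs⟩ := Module.projective_def'.1 ‹Module.Projective A Q›
  refine (hA.finsupp Q).of_retract (s.restrictScalars R)
    ((Finsupp.linearCombination A id).restrictScalars R) ?_
  ext y
  exact LinearMap.congr_fun hs y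

end HomOfProjective

/-! ### Extension of scalars along a quotient map -/

namespace NCExtendScalars

variable {A B : Type u} [Ring A] [Ring B] (f : A →+* B)

section

variable (M : Type u) [AddCommGroup M] [Module A M]

/-- The canonical semilinear map `M → B ⊗_A M`. -/
def unit : M →ₛₗ[f] ((B ⊗[ℤ] M) ⧸ relations f M) where
  toFun m := Submodule.Quotient.mk (1 ⊗ₜ[ℤ] m)
  map_add' m m' := by rw [TensorProduct.tmul_add, Submodule.Quotient.mk_add]
  map_smul' a m := by
    rw [← Submodule.Quotient.mk_smul, eq_comm, Submodule.Quotient.eq]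
    refine Submodule.subset_span ⟨1, a, m, ?_⟩
    rw [TensorProduct.smul_tmul', smul_eq_mul, one_mul, mul_one]

variable {M} in
theorem mk_tmul (b : B) (m : M) :
    (Submodule.Quotient.mk (b ⊗ₜ[ℤ] m) : (B ⊗[ℤ] M) ⧸ relations f M) = b • unit f M m := by
  change _ = b • (Submodule.Quotient.mk (1 ⊗ₜ[ℤ] m) : (B ⊗[ℤ] M) ⧸ relations f M)
  rw [← Submodule.Quotient.mk_smul, TensorProduct.smul_tmul', smul_eq_mul, mul_one]

variable {M} {f} in
theorem hom_ext_unit {N : Type u} [AddCommGroup N] [Module B N]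
    {g h : ((B ⊗[ℤ] M) ⧸ relations f M) →ₗ[B] N} (H : ∀ m, g (unit f M m) = h (unit f M m)) :
    g = h :=
  hom_ext f fun b m => by rw [mk_tmul, map_smul, map_smul, H]

@[simp]
theorem mapLinear_unit {M N : Type u} [AddCommGroup M] [Module A M] [AddCommGroup N] [Module A N]
    (g : M →ₗ[A] N) (m : M) : mapLinear f g (unit f M m) = unit f N (g m) :=
  rfl

variable {f}

theorem unit_surjective (hf : Function.Surjective f) : Function.Surjective (unit f M) := by
  intro x
  obtain ⟨x, rfl⟩ := Submodule.Quotient.mk_surjective _ x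
  induction x using TensorProduct.induction_on with
  | zero => exact ⟨0, by rw [map_zero, Submodule.Quotient.mk_zero]⟩
  | tmul b m =>
    obtain ⟨a, rfl⟩ := hf b
    exact ⟨a • m, by rw [mk_tmul, LinearMap.map_smulₛₗ]⟩
  | add x y hx hy =>
    obtain ⟨m, hm⟩ := hx
    obtain ⟨m', hm'⟩ := hy
    exact ⟨m + m', by rw [map_add, hm, hm', Submodule.Quotient.mk_add]⟩

variable {M}

/-- Modulo `S`, the action of `a` depends only on `f a`, so `b ⊗ m ↦ σ(b) m` is a well-defined
additive map to `M ⧸ S` for any section `σ` of `f`. It factors the quotient map through `unit`. -/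
theorem mem_of_unit_eq_zero (hf : Function.Surjective f) {S : AddSubgroup M}
    (hS : ∀ a, f a = 0 → ∀ m, a • m ∈ S) {m : M} (hm : unit f M m = 0) : m ∈ S := by
  let σ := Function.surjInv hf
  have hσ : ∀ b, f (σ b) = b := Function.surjInv_eq hf
  have key : ∀ a a', f a = f a' → ∀ m : M,
      (QuotientAddGroup.mk (a • m) : M ⧸ S) = QuotientAddGroup.mk (a' • m) := fun a a' h m => by
    rw [eq_comm, QuotientAddGroup.eq, neg_add_eq_sub, ← sub_smul]
    exact hS _ (by rw [map_sub, h, sub_self]) m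
  let φ : B ⊗[ℤ] M →+ M ⧸ S := TensorProduct.liftAddHom
    (AddMonoidHom.mk' (fun b => AddMonoidHom.mk' (fun m => QuotientAddGroup.mk (σ b • m))
      (fun m m' => by rw [smul_add, QuotientAddGroup.mk_add]))
      (fun b b' => by
        ext m
        change (QuotientAddGroup.mk (σ (b + b') • m) : M ⧸ S) =
          QuotientAddGroup.mk (σ b • m) + QuotientAddGroup.mk (σ b' • m)
        rw [← QuotientAddGroup.mk_add, ← add_smul]
        exact key _ _ (by simp [hσ]) m))
    (fun r b m => by
      change (QuotientAddGroup.mk (σ (r • b) • m) : M ⧸ S) =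
          QuotientAddGroup.mk (σ b • (r • m))
      rw [← smul_comm, ← smul_assoc]
      exact key _ _ (by rw [map_zsmul, hσ, hσ]) m)
  have hφt : ∀ b m, φ (b ⊗ₜ m) = QuotientAddGroup.mk (σ b • m) := fun _ _ => rfl
  -- The relations form a `B`-span while `φ` is only additive; quantifying over the multiplier `b`
  -- makes the span induction go through.
  have hφ : ∀ x ∈ relations f M, ∀ b : B, φ (b • x) = 0 := by
    intro x hx
    induction hx using Submodule.span_induction with
    | mem x hx =>
      obtain ⟨b, a, m, rfl⟩ := hx
      intro b'
      rw [smul_sub, map_sub, TensorProduct.smul_tmul', TensorProduct.smul_tmul', hφt, hφt,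
        sub_eq_zero, ← mul_smul]
      exact key _ _ (by simp [hσ, mul_assoc]) m
    | zero => simp
    | add x y _ _ hx hy => intro b; rw [smul_add, map_add, hx, hy, add_zero]
    | smul b' x _ hx => intro b; rw [← mul_smul, hx]
  have h1 := hφ _ ((Submodule.Quotient.mk_eq_zero _).1 hm) 1
  rw [one_smul, hφt, key (σ 1) 1 (by rw [hσ, map_one]), one_smul] at h1
  exact (QuotientAddGroup.eq_zero_iff m).1 h1

end

/-! ### Projective modules under extension of scalars -/

section Projective

variable {f} {P : Type u} [AddCommGroup P] [Module A P] [Module.Projective A P]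

/-- A semilinear map out of a projective module lifts along surjective semilinear maps. -/
theorem exists_lift {M N : Type*} [AddCommGroup M] [Module A M] [AddCommGroup N] [Module B N]
    (p : M →ₛₗ[f] N) (hp : Function.Surjective p) (g : P →ₛₗ[f] N) :
    ∃ l : P →ₗ[A] M, ∀ x, p (l x) = g x := by
  let : Module A N := Module.compHom N f
  let p' : M →ₗ[A] N := { toFun := p, map_add' := p.map_add, map_smul' := p.map_smulₛₗ }
  let g' : P →ₗ[A] N := { toFun := g, map_add' := g.map_add, map_smul' := g.map_smulₛₗ }
  obtain ⟨l, hl⟩ := Module.projective_lifting_property p' g' hp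
  exact ⟨l, LinearMap.congr_fun hl⟩

/-- The `B`-linear map `B ⊗_A M → N` induced by a semilinear map `M → N`. -/
def lift {M N : Type u} [AddCommGroup M] [Module A M] [AddCommGroup N] [Module B N]
    (g : M →ₛₗ[f] N) : ((B ⊗[ℤ] M) ⧸ relations f M) →ₗ[B] N :=
  (relations f M).liftQ (TensorProduct.AlgebraTensorModule.lift
    (LinearMap.toSpanSingleton B (M →ₗ[ℤ] N) g.toAddMonoidHom.toIntLinearMap)) (by
      rw [relations, Submodule.span_le]
      rintro _ ⟨b, a, m, rfl⟩
      change _ = _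
      rw [map_sub, sub_eq_zero]
      change (b * f a) • g m = b • g (a • m)
      rw [LinearMap.map_smulₛₗ, mul_smul])

theorem lift_unit {M N : Type u} [AddCommGroup M] [Module A M] [AddCommGroup N] [Module B N]
    (g : M →ₛₗ[f] N) (m : M) : lift g (unit f M m) = g m :=
  one_smul B (g m)

/-- `B`-linear maps out of `B ⊗_A P` are semilinear maps out of `P`, and these lift along
surjections. -/
instance projective : Module.Projective B ((B ⊗[ℤ] P) ⧸ relations f P) := by
  refine Module.Projective.of_lifting_property'' fun p hp => ?_
  let : Module A (((B ⊗[ℤ] P) ⧸ relations f P) →₀ B) := Module.compHom _ f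
  let i : (((B ⊗[ℤ] P) ⧸ relations f P) →₀ B) →ₛₗ[f] (((B ⊗[ℤ] P) ⧸ relations f P) →₀ B) :=
    { toFun := id, map_add' := fun _ _ => rfl, map_smul' := fun _ _ => rfl }
  obtain ⟨l, hl⟩ := exists_lift (p ∘ₛₗ i) hp (unit f P)
  refine ⟨lift (i ∘ₛₗ l), hom_ext_unit fun m => ?_⟩
  rw [LinearMap.comp_apply, lift_unit]
  exact hl m

theorem mapLinear_surjective (hf : Function.Surjective f) (Q : Type u) [AddCommGroup Q]
    [Module A Q] : Function.Surjective (mapLinear f : (P →ₗ[A] Q) → _) := by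
  intro g
  obtain ⟨l, hl⟩ := exists_lift (unit f Q) (unit_surjective Q hf) (g ∘ₛₗ unit f P)
  exact ⟨l, hom_ext_unit fun m => hl m⟩

end Projective

/-! ### Extension of scalars along the quotient by an ideal of the base ring -/

section Ideal

variable {R : Type*} [CommRing R] {𝔞 : Ideal R} [Algebra R A] [Algebra (R ⧸ 𝔞) B] {f}

theorem unit_algebraMap_smul
    (hfR : ∀ r, f (algebraMap R A r) = algebraMap (R ⧸ 𝔞) B (Ideal.Quotient.mk 𝔞 r))
    (M : Type u) [AddCommGroup M] [Module A M] (r : R) (m : M) :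
    unit f M (algebraMap R A r • m) =
      algebraMap (R ⧸ 𝔞) B (Ideal.Quotient.mk 𝔞 r) • unit f M m := by
  rw [LinearMap.map_smulₛₗ, hfR]

/-- The hypotheses `hf`, `hfR` and `hker` say that `B` is `A / 𝔞A`. Keeping `B` abstract lets the
result apply to the opposite of a quotient ring, which is not literally a quotient of the opposite
ring. -/
theorem unit_eq_zero_iff (hf : Function.Surjective f)
    (hfR : ∀ r, f (algebraMap R A r) = algebraMap (R ⧸ 𝔞) B (Ideal.Quotient.mk 𝔞 r))
    (hker : ∀ a, f a = 0 → a ∈ 𝔞.map (algebraMap R A))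
    {M : Type u} [AddCommGroup M] [Module A M] [Module R M] [IsScalarTower R A M] (m : M) :
    unit f M m = 0 ↔ m ∈ 𝔞 • (⊤ : Submodule R M) := by
  constructor
  · intro hm
    have key : ∀ a ∈ 𝔞.map (algebraMap R A), ∀ m : M, a • m ∈ 𝔞 • (⊤ : Submodule R M) := by
      intro a ha
      induction ha using Submodule.span_induction with
      | mem x hx =>
        obtain ⟨r, hr, rfl⟩ := hx
        intro m
        rw [algebraMap_smul]
        exact Submodule.smul_mem_smul hr trivial
      | zero => simp
      | add x y _ _ hx hy =>
        intro m
        rw [add_smul]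
        exact add_mem (hx m) (hy m)
      | smul b x _ hx =>
        intro m
        have h1 := Submodule.mem_map_of_mem (f := Algebra.lsmul R R M b) (hx m)
        rw [Submodule.map_smul''] at h1
        rw [smul_eq_mul, mul_smul]
        exact Submodule.smul_mono le_rfl le_top h1
    exact mem_of_unit_eq_zero hf (S := (𝔞 • (⊤ : Submodule R M)).toAddSubgroup)
      (fun a ha m => key a (hker a ha) m) hm
  · intro hm
    refine Submodule.smul_induction_on hm (fun r hr m _ => ?_) (fun x y hx hy => ?_)
    · rw [← algebraMap_smul A, unit_algebraMap_smul hfR, Ideal.Quotient.eq_zero_iff_mem.2 hr,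
        map_zero, zero_smul]
    · rw [map_add, hx, hy, add_zero]

theorem mapLinear_eq_zero_iff (hf : Function.Surjective f)
    (hfR : ∀ r, f (algebraMap R A r) = algebraMap (R ⧸ 𝔞) B (Ideal.Quotient.mk 𝔞 r))
    (hker : ∀ a, f a = 0 → a ∈ 𝔞.map (algebraMap R A))
    {P Q : Type u} [AddCommGroup P] [Module A P] [Module.Projective A P] [Module.Finite A P]
    [AddCommGroup Q] [Module A Q] [Module R Q] [IsScalarTower R A Q] (g : P →ₗ[A] Q) :
    mapLinear f g = 0 ↔ g ∈ 𝔞 • (⊤ : Submodule R (P →ₗ[A] Q)) := by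
  constructor
  · intro hg
    refine linearMap_mem_smul_top fun x => ?_
    rw [← unit_eq_zero_iff hf hfR hker, ← mapLinear_unit, hg, LinearMap.zero_apply]
  · intro hg
    refine hom_ext_unit fun m => ?_
    rw [mapLinear_unit, LinearMap.zero_apply, unit_eq_zero_iff hf hfR hker]
    let ev : (P →ₗ[A] Q) →ₗ[R] Q :=
      { toFun := fun g => g m, map_add' := fun _ _ => rfl, map_smul' := fun _ _ => rfl }
    have h1 := Submodule.mem_map_of_mem (f := ev) hg
    rw [Submodule.map_smul''] at h1
    exact Submodule.smul_mono le_rfl le_top h1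

end Ideal

end NCExtendScalars

/-! ### Homomorphisms in categories of modules over an algebra -/

section ModuleCatOfAlgebra

variable {R : Type u} [CommRing R] {A : Type u} [Ring A] [Algebra R A]

theorem ModuleCat.torIndependent_hom {Y : ModuleCat.{u} R} {F : ProjectiveResolution Y}
    (hA : TorIndependent F A) (P Q : ModuleCat.{u} A) [Module.Finite A P] [Module.Projective A P]
    [Module.Projective A Q] : TorIndependent F (P ⟶ Q) := by
  let : Module R Q := Module.restrictScalars R A Q
  have : IsScalarTower R A Q := IsScalarTower.restrictScalars R A Q
  exact (torIndependent_linearMap hA P Q).of_linearEquiv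
    (ModuleCat.homLinearEquiv (S := R)).symm

theorem ModuleCat.finite_hom [IsNoetherianRing R] [Module.Finite R A] (P Q : ModuleCat.{u} A)
    [Module.Finite A P] [Module.Finite A Q] : Module.Finite R (P ⟶ Q) := by
  let : Module R Q := Module.restrictScalars R A Q
  have : IsScalarTower R A Q := IsScalarTower.restrictScalars R A Q
  have : Module.Finite R Q := Module.Finite.trans A Q
  have : Module.Finite R (P →ₗ[A] Q) := linearMap_finite
  exact Module.Finite.equiv (ModuleCat.homLinearEquiv (S := R)).symm

variable {𝔞 : Ideal R} {B : Type u} [Ring B] [Algebra (R ⧸ 𝔞) B] {f : A →+* B}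

theorem ncExtendScalars_map_surjective (hf : Function.Surjective f) (P Q : ModuleCat.{u} A)
    [Module.Projective A P] :
    Function.Surjective ((ncExtendScalars f).map : (P ⟶ Q) → _) := by
  intro g
  obtain ⟨l, hl⟩ := NCExtendScalars.mapLinear_surjective hf Q g.hom
  exact ⟨ModuleCat.ofHom l, ModuleCat.hom_ext hl⟩

theorem ncExtendScalars_map_smul
    (hfR : ∀ r, f (algebraMap R A r) = algebraMap (R ⧸ 𝔞) B (Ideal.Quotient.mk 𝔞 r))
    {P Q : ModuleCat.{u} A} (r : R) (g : P ⟶ Q) :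
    (ncExtendScalars f).map (r • g) = Ideal.Quotient.mk 𝔞 r • (ncExtendScalars f).map g :=
  ModuleCat.hom_ext (NCExtendScalars.hom_ext_unit fun m =>
    NCExtendScalars.unit_algebraMap_smul hfR Q r (g.hom m))

theorem ncExtendScalars_map_eq_zero_iff (hf : Function.Surjective f)
    (hfR : ∀ r, f (algebraMap R A r) = algebraMap (R ⧸ 𝔞) B (Ideal.Quotient.mk 𝔞 r))
    (hker : ∀ a, f a = 0 → a ∈ 𝔞.map (algebraMap R A))
    {P Q : ModuleCat.{u} A} [Module.Projective A P] [Module.Finite A P] (g : P ⟶ Q) :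
    (ncExtendScalars f).map g = 0 ↔ g ∈ 𝔞 • (⊤ : Submodule R (P ⟶ Q)) := by
  let : Module R Q := Module.restrictScalars R A Q
  have : IsScalarTower R A Q := IsScalarTower.restrictScalars R A Q
  have h1 := NCExtendScalars.mapLinear_eq_zero_iff hf hfR hker g.hom
  let e : (P ⟶ Q) ≃ₗ[R] (P →ₗ[A] Q) := ModuleCat.homLinearEquiv (S := R)
  have h2 : g.hom ∈ 𝔞 • (⊤ : Submodule R (P →ₗ[A] Q)) ↔ g ∈ 𝔞 • (⊤ : Submodule R (P ⟶ Q)) := by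
    have : 𝔞 • (⊤ : Submodule R (P →ₗ[A] Q)) =
        (𝔞 • (⊤ : Submodule R (P ⟶ Q))).map e.toLinearMap := by
      rw [Submodule.map_smul'', Submodule.map_top, LinearEquiv.range]
    rw [this]
    exact e.injective.mem_set_image (s := (𝔞 • (⊤ : Submodule R (P ⟶ Q)) : Submodule R _))
  rw [← h2, ← h1]
  exact ⟨fun h => congrArg ModuleCat.Hom.hom h, fun h => ModuleCat.hom_ext h⟩

end ModuleCatOfAlgebra

/-! ### Reduction of complexes of homomorphisms -/

section Cochains

open CochainComplex CochainComplex.HomComplex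

variable {C : Type*} [Category* C] [Preadditive C] {R : Type u} [CommRing R] [Linear R C]
  (P Q : CochainComplex C ℤ) (a b n : ℤ)

variable (R) in
/-- The components of a cochain whose sources have degrees in `[a, b]`. -/
noncomputable def cochainComponents :
    Cochain P Q n →ₗ[R] (∀ p : Finset.Icc a b, P.X p ⟶ Q.X (p + n)) where
  toFun z p := z.v p (p + n) rfl
  map_add' _ _ := rfl
  map_smul' _ _ := rfl

variable (R) in
/-- The cochain with given components in source degrees in `[a, b]`, extended by zero. -/
noncomputable def cochainOfComponents :
    (∀ p : Finset.Icc a b, P.X p ⟶ Q.X (p + n)) →ₗ[R] Cochain P Q n where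
  toFun w := Cochain.mk fun p q hpq =>
    if h : p ∈ Finset.Icc a b then w ⟨p, h⟩ ≫ eqToHom (by rw [hpq]) else 0
  map_add' w w' := by
    ext p q hpq
    simp only [Cochain.mk_v, Cochain.add_v]
    split_ifs <;> simp
  map_smul' r w := by
    ext p q hpq
    simp only [Cochain.mk_v, Cochain.smul_v]
    split_ifs <;> simp

/-- Boundedness of `P` makes the group of cochains a finite product, so Tor-independence and
multiples of `I` can be tested componentwise. -/
theorem cochainOfComponents_components [P.IsStrictlyGE a] [P.IsStrictlyLE b] :
    cochainOfComponents R P Q a b n ∘ₗ cochainComponents R P Q a b n = LinearMap.id := by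
  ext z p q hpq
  change dite _ _ _ = z.v p q hpq
  subst hpq
  split_ifs with h
  · exact Category.comp_id _
  · rw [Finset.mem_Icc, not_and_or, not_le, not_le] at h
    refine IsZero.eq_of_src ?_ _ _
    rcases h with h | h
    · exact P.isZero_of_isStrictlyGE a p h
    · exact P.isZero_of_isStrictlyLE b p h

theorem torIndependent_cochain [P.IsStrictlyGE a] [P.IsStrictlyLE b] {Y : ModuleCat.{u} R}
    {F : ProjectiveResolution Y} (h : ∀ p q, TorIndependent F (P.X p ⟶ Q.X q)) :
    TorIndependent F (Cochain P Q n) :=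
  TorIndependent.of_retract (.pi fun _ => h _ _) _ _ (cochainOfComponents_components P Q a b n)

theorem cochain_mem_smul_top [P.IsStrictlyGE a] [P.IsStrictlyLE b] {I : Ideal R}
    (z : Cochain P Q n) (h : ∀ p q hpq, z.v p q hpq ∈ I • (⊤ : Submodule R (P.X p ⟶ Q.X q))) :
    z ∈ I • (⊤ : Submodule R (Cochain P Q n)) := by
  have h1 : cochainComponents R P Q a b n z ∈ I • (⊤ : Submodule R _) :=
    mem_smul_top_pi fun p => h p (p + n) rfl
  have h2 := Submodule.mem_map_of_mem (f := cochainOfComponents R P Q a b n) h1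
  rw [Submodule.map_smul'', ← LinearMap.comp_apply, cochainOfComponents_components] at h2
  exact Submodule.smul_mono le_rfl le_top h2

theorem finite_hom_of_bounded [IsNoetherianRing R] [P.IsStrictlyGE a] [P.IsStrictlyLE b]
    (h : ∀ p q, Module.Finite R (P.X p ⟶ Q.X q)) : Module.Finite R (P ⟶ Q) := by
  let φ : (P ⟶ Q) →ₗ[R] (∀ p : Finset.Icc a b, P.X p ⟶ Q.X p) :=
    { toFun := fun g p => g.f p, map_add' := fun _ _ => rfl, map_smul' := fun _ _ => rfl }
  refine Module.Finite.of_injective φ fun g g' hg => ?_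
  ext p
  by_cases hp : p ∈ Finset.Icc a b
  · exact congrFun hg ⟨p, hp⟩
  · rw [Finset.mem_Icc, not_and_or, not_le, not_le] at hp
    refine IsZero.eq_of_src ?_ _ _
    rcases hp with h | h
    · exact P.isZero_of_isStrictlyGE a p h
    · exact P.isZero_of_isStrictlyLE b p h

variable {D : Type*} [Category* D] [Preadditive D] (T : C ⥤ D) [T.Additive]

/-- Applying an additive functor to cochains, as a homomorphism. -/
noncomputable def cochainMapAddHom :
    Cochain P Q n →+ Cochain ((T.mapHomologicalComplex (.up ℤ)).obj P)
      ((T.mapHomologicalComplex (.up ℤ)).obj Q) n where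
  toFun z := z.map T
  map_zero' := Cochain.map_zero P Q n T
  map_add' z z' := Cochain.map_add z z' T

theorem isReduction_cochain [P.IsStrictlyGE a] [P.IsStrictlyLE b] [Q.IsStrictlyLE n]
    {𝔞 : Ideal R} {F : ProjectiveResolution (ModuleCat.of R (R ⧸ 𝔞))}
    (h : ∀ p q, TorIndependent F (P.X p ⟶ Q.X q))
    (hsurj : ∀ p q, Function.Surjective (T.map : (P.X p ⟶ Q.X q) → _))
    (hker : ∀ p q (g : P.X p ⟶ Q.X q), T.map g = 0 ↔ g ∈ 𝔞 • (⊤ : Submodule R (P.X p ⟶ Q.X q))) :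
    IsReduction F (fun i => δ_hom R P Q i (i + 1))
      (fun i => (δ_hom ℤ ((T.mapHomologicalComplex (.up ℤ)).obj P)
        ((T.mapHomologicalComplex (.up ℤ)).obj Q) i (i + 1)).toAddMonoidHom)
      (fun i => cochainMapAddHom P Q i T) where
  d_d i x := δ_δ _ _ _ x
  bounded := by
    -- A nonzero component goes from degree `p ≥ a` to degree `p + i ≤ n`, which forces `i ≤ n - a`.
    refine ⟨n - a, fun i hi => ⟨fun z z' => ?_⟩⟩
    ext p q hpq
    rcases lt_or_ge p a with hp | hp
    · exact (P.isZero_of_isStrictlyGE a p hp).eq_of_src _ _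
    · exact (Q.isZero_of_isStrictlyLE n q (by lia)).eq_of_tgt _ _
  torIndependent i := torIndependent_cochain P Q a b i h
  surjective i z := by
    choose g hg using hsurj
    exact ⟨Cochain.mk fun p q hpq => g p q (z.v p q hpq), by ext p q hpq; exact hg _ _ _⟩
  eq_zero_iff i z := by
    constructor
    · intro hz
      refine cochain_mem_smul_top P Q a b i z fun p q hpq => ?_
      rw [← hker]
      exact Cochain.congr_v hz p q hpq
    · intro hz
      ext p q hpq
      change T.map (z.v p q hpq) = 0
      rw [hker]
      let ev : Cochain P Q i →ₗ[R] (P.X p ⟶ Q.X q) :=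
        { toFun := fun z => z.v p q hpq, map_add' := fun _ _ => rfl, map_smul' := fun _ _ => rfl }
      have h1 := Submodule.mem_map_of_mem (f := ev) hz
      rw [Submodule.map_smul''] at h1
      exact Submodule.smul_mono le_rfl le_top h1
  comm i z := (δ_map i (i + 1) z T).symm

end Cochains

/-! ### Morphisms in the homotopy category and cohomology of complexes of homomorphisms -/

section CohomologyOfHomComplex

open CochainComplex CochainComplex.HomComplex

variable {C : Type*} [Category* C] [Preadditive C]

theorem subsingleton_hom_shift_iff (K L : CochainComplex C ℤ) (j : ℤ) :
    Subsingleton ((HomotopyCategory.quotient C (.up ℤ)).obj K ⟶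
      (HomotopyCategory.quotient C (.up ℤ)).obj (L⟦j + 1⟧)) ↔
    ∀ z : Cochain K L (j + 1), δ (j + 1) (j + 1 + 1) z = 0 → ∃ y, δ j (j + 1) y = z := by
  rw [← (Equiv.ofBijective _ (CohomologyClass.toHom_bijective K L (j + 1))).subsingleton_congr]
  constructor
  · intro h z hz
    have h1 : CohomologyClass.mk (Cocycle.mk z _ rfl hz) = 0 := Subsingleton.elim _ _
    rw [CohomologyClass.mk_eq_zero_iff, mem_coboundaries_iff _ j rfl] at h1
    exact h1
  · intro h
    refine subsingleton_of_forall_eq 0 fun x => ?_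
    obtain ⟨z, rfl⟩ := x.mk_surjective
    rw [CohomologyClass.mk_eq_zero_iff, mem_coboundaries_iff _ j rfl]
    exact h z.1 z.2

variable {R : Type*} [CommRing R] [Linear R C]

variable (R) in
/-- The morphism in the homotopy category that corresponds to a cocycle. -/
noncomputable def cocycleToHom (K L : CochainComplex C ℤ) (n : ℤ) :
    (δ_hom R K L n (n + 1)).ker →ₗ[R] ((HomotopyCategory.quotient C (.up ℤ)).obj K ⟶
      (HomotopyCategory.quotient C (.up ℤ)).obj (L⟦n⟧)) where
  toFun z := CohomologyClass.toHom (.mk (Cocycle.mk z.1 _ rfl z.2))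
  map_add' z z' := by
    rw [← map_add, ← CohomologyClass.mk_add]
    rfl
  map_smul' r z := by
    simp only [CohomologyClass.toHom_mk, RingHom.id_apply, ← Functor.map_smul]
    congr 1
    ext p
    simp [Cocycle.equivHomShift, Cochain.rightShift_v _ _ _ _ p p _ _ rfl]
    rfl

/-- Generators of the cohomology are lifted to cocycles, which span `S`. This is the input for
Nakayama's lemma when the cochains are not finitely generated. -/
theorem exists_fg_cocycles (K L : CochainComplex C ℤ) (j : ℤ)
    [Module.Finite R ((HomotopyCategory.quotient C (.up ℤ)).obj K ⟶
      (HomotopyCategory.quotient C (.up ℤ)).obj (L⟦j + 1⟧))] :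
    ∃ S : Submodule R (Cochain K L (j + 1)), S.FG ∧ S ≤ (δ_hom R K L (j + 1) (j + 1 + 1)).ker ∧
      (δ_hom R K L (j + 1) (j + 1 + 1)).ker ≤ (δ_hom R K L j (j + 1)).range ⊔ S := by
  obtain ⟨n, p, hp⟩ := Module.Finite.exists_fin' R
    ((HomotopyCategory.quotient C (.up ℤ)).obj K ⟶
      (HomotopyCategory.quotient C (.up ℤ)).obj (L⟦j + 1⟧))
  have hκ : Function.Surjective (cocycleToHom R K L (j + 1)) := fun φ => by
    obtain ⟨x, rfl⟩ := (CohomologyClass.toHom_bijective K L (j + 1)).surjective φ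
    obtain ⟨z, rfl⟩ := x.mk_surjective
    exact ⟨⟨z.1, z.2⟩, rfl⟩
  obtain ⟨g, hg⟩ := Module.projective_lifting_property _ p hκ
  let i := (δ_hom R K L (j + 1) (j + 1 + 1)).ker.subtype
  refine ⟨(i ∘ₗ g).range, ?_, ?_, fun z hz => ?_⟩
  · rw [LinearMap.range_eq_map]
    exact (Module.Finite.fg_top).map _
  · rintro _ ⟨v, rfl⟩
    exact (g v).2
  · obtain ⟨v, hv⟩ := hp (cocycleToHom R K L (j + 1) ⟨z, hz⟩)
    have h1 : cocycleToHom R K L (j + 1) (⟨z, hz⟩ - g v) = 0 := by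
      rw [map_sub, ← hv, ← hg, LinearMap.comp_apply, sub_self]
    have h2 := (CohomologyClass.toHom_mk_eq_zero_iff _).1 h1
    rw [mem_coboundaries_iff _ j rfl] at h2
    obtain ⟨y, hy⟩ := h2
    rw [← sub_add_cancel z (i (g v))]
    exact Submodule.add_mem_sup ⟨y, hy⟩ ⟨v, rfl⟩

end CohomologyOfHomComplex

/-! ### Morphisms in the derived category out of K-projective complexes -/

section KProjective

open CochainComplex CochainComplex.HomComplex

variable {C : Type*} [Category* C] [Abelian C] [HasDerivedCategory C]

theorem subsingleton_hom_shift_iff_of_iso {X Y : DerivedCategory C} {K L : CochainComplex C ℤ}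
    [K.IsKProjective]
    (eX : DerivedCategory.Qh.obj ((HomotopyCategory.quotient C (.up ℤ)).obj K) ≅ X)
    (eY : DerivedCategory.Qh.obj ((HomotopyCategory.quotient C (.up ℤ)).obj L) ≅ Y) (i : ℤ) :
    Subsingleton (X ⟶ Y⟦i⟧) ↔
      Subsingleton ((HomotopyCategory.quotient C (.up ℤ)).obj K ⟶
        (HomotopyCategory.quotient C (.up ℤ)).obj (L⟦i⟧)) := by
  have e : DerivedCategory.Qh.obj ((HomotopyCategory.quotient C (.up ℤ)).obj (L⟦i⟧)) ≅ Y⟦i⟧ :=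
    (DerivedCategory.quotientCompQhIso C).app _ ≪≫ (DerivedCategory.Q.commShiftIso i).app L ≪≫
      (CategoryTheory.shiftFunctor _ i).mapIso
        ((DerivedCategory.quotientCompQhIso C).symm.app L ≪≫ eY)
  rw [(Equiv.ofBijective _ (IsKProjective.Qh_map_bijective K _)).subsingleton_congr,
    (Iso.homCongr eX e).subsingleton_congr]

/-- Morphisms out of a K-projective complex are the same in the homotopy and derived categories, so
`Hom(X, Y[i])` is the cohomology of the complex of homomorphisms. `ExactAbove` at `m` concerns the
degrees `j + 1` with `j ≥ m`, that is `i > m`. -/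
theorem exactAbove_iff {X Y : DerivedCategory C} {K L : CochainComplex C ℤ}
    [K.IsKProjective]
    (eX : DerivedCategory.Qh.obj ((HomotopyCategory.quotient C (.up ℤ)).obj K) ≅ X)
    (eY : DerivedCategory.Qh.obj ((HomotopyCategory.quotient C (.up ℤ)).obj L) ≅ Y) (m : ℤ) :
    ExactAbove (fun i => (δ_hom ℤ K L i (i + 1)).toAddMonoidHom) m ↔
      ∀ i, m < i → ∀ φ : X ⟶ Y⟦i⟧, φ = 0 := by
  have h : ∀ i, (∀ φ : X ⟶ Y⟦i⟧, φ = 0) ↔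
      Subsingleton ((HomotopyCategory.quotient C (.up ℤ)).obj K ⟶
        (HomotopyCategory.quotient C (.up ℤ)).obj (L⟦i⟧)) := fun i => by
    rw [← subsingleton_hom_shift_iff_of_iso eX eY i]
    exact ⟨fun h => subsingleton_of_forall_eq 0 h, fun h φ => Subsingleton.elim _ _⟩
  simp only [h]
  constructor
  · intro hm i hi
    obtain ⟨j, rfl⟩ : ∃ j, i = j + 1 := ⟨i - 1, by lia⟩
    exact (subsingleton_hom_shift_iff K L j).2 (hm j (by lia))
  · intro hm j hj
    exact (subsingleton_hom_shift_iff K L j).1 (hm (j + 1) (by lia))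

/-- Every morphism in the derived category from `K` to `L'` comes from a chain map, as `K` is
K-projective. So finiteness can be read off any complex `L'` isomorphic to `L` there, projective or
not. -/
theorem finite_homotopyCategory_hom {R : Type*} [CommRing R] [IsNoetherianRing R] [Linear R C]
    {K L L' : CochainComplex C ℤ} [K.IsKProjective] [Module.Finite R (K ⟶ L')]
    (e : DerivedCategory.Qh.obj ((HomotopyCategory.quotient C (.up ℤ)).obj L') ≅
      DerivedCategory.Qh.obj ((HomotopyCategory.quotient C (.up ℤ)).obj L)) :
    Module.Finite R ((HomotopyCategory.quotient C (.up ℤ)).obj K ⟶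
      (HomotopyCategory.quotient C (.up ℤ)).obj L) := by
  let q := HomotopyCategory.quotient C (.up ℤ)
  let φ : (K ⟶ L') →ₗ[R] (DerivedCategory.Qh.obj (q.obj K) ⟶ DerivedCategory.Qh.obj (q.obj L)) :=
    Linear.rightComp R _ e.hom ∘ₗ (DerivedCategory.Qh.mapLinearMap R) ∘ₗ (q.mapLinearMap R)
  have hφ : Function.Surjective φ := fun ψ => by
    obtain ⟨ψ', hψ'⟩ := (IsKProjective.Qh_map_bijective K _).surjective (ψ ≫ e.inv)
    obtain ⟨g, rfl⟩ := q.map_surjective ψ'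
    refine ⟨g, ?_⟩
    change DerivedCategory.Qh.map (q.map g) ≫ e.hom = ψ
    rw [hψ', Category.assoc, e.inv_hom_id, Category.comp_id]
  have := Module.Finite.of_surjective φ hφ
  exact Module.Finite.of_injective (DerivedCategory.Qh.mapLinearMap R)
    (IsKProjective.Qh_map_bijective K (q.obj L)).injective

end KProjective

/-! ### Projective resolutions -/

section ProjRes

variable {C : Type*} [Category* C] [Abelian C] [HasDerivedCategory C] [EnoughProjectives C]

instance (X : DMinus C) : (projRes X).cx.IsKProjective := (projRes X).isKProjective

theorem projResMap_add {X Y : DMinus C} (φ ψ : X ⟶ Y) :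
    projResMap (φ + ψ) = projResMap φ + projResMap ψ :=
  (projResMap_unique _ _ (by
    rw [Functor.map_add, Preadditive.add_comp, projResMap_comm, projResMap_comm,
      ← Preadditive.comp_add]
    rfl)).symm

theorem projResMap_surjective {X Y : DMinus C} (ψ : projResObj X ⟶ projResObj Y) :
    ∃ φ : X ⟶ Y, projResMap φ = ψ :=
  ⟨ObjectProperty.homMk ((projRes X).iso.inv ≫ DerivedCategory.Qh.map ψ ≫ (projRes Y).iso.hom),
    (projResMap_unique _ _ (by simp)).symm⟩

theorem hom_eq_of_projResMap {X Y : DMinus C} (φ : X ⟶ Y) :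
    φ.hom = (projRes X).iso.inv ≫ DerivedCategory.Qh.map (projResMap φ) ≫ (projRes Y).iso.hom := by
  rw [projResMap_comm, Iso.inv_hom_id_assoc]

/-- A K-projective complex that represents an object is homotopy equivalent to its chosen
projective resolution. -/
theorem exists_iso_projResObj {X : DMinus C} {K : CochainComplex C ℤ} [K.IsKProjective]
    (e : DerivedCategory.Qh.obj ((HomotopyCategory.quotient C (.up ℤ)).obj K) ≅ X.obj) :
    Nonempty ((HomotopyCategory.quotient C (.up ℤ)).obj K ≅ projResObj X) := by
  have h1 := CochainComplex.IsKProjective.Qh_map_bijective K (projResObj X)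
  have h2 := CochainComplex.IsKProjective.Qh_map_bijective (projRes X).cx
    ((HomotopyCategory.quotient C (.up ℤ)).obj K)
  obtain ⟨u, hu⟩ := h1.surjective (e.hom ≫ (projRes X).iso.inv)
  obtain ⟨v, hv⟩ := h2.surjective ((projRes X).iso.hom ≫ e.inv)
  refine ⟨u, v, (CochainComplex.IsKProjective.Qh_map_bijective K _).injective ?_,
    (CochainComplex.IsKProjective.Qh_map_bijective (projRes X).cx _).injective ?_⟩
  · rw [Functor.map_comp, hu, hv]; simp
  · rw [Functor.map_comp, hu, hv]; simp

theorem isKProjective_mapHomologicalComplex {C D : Type*} [Category* C] [Abelian C] [Category* D]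
    [Abelian D] (T : C ⥤ D) [T.Additive] (hT : ∀ X : C, Projective X → Projective (T.obj X))
    (K : CochainComplex C ℤ) (n : ℤ) [K.IsStrictlyLE n] (hK : ∀ i, Projective (K.X i)) :
    CochainComplex.IsKProjective ((T.mapHomologicalComplex (.up ℤ)).obj K) := by
  have : ∀ i, Projective (((T.mapHomologicalComplex (.up ℤ)).obj K).X i) := fun i => hT _ (hK i)
  have : CochainComplex.IsStrictlyLE ((T.mapHomologicalComplex (.up ℤ)).obj K) n := inferInstance
  exact CochainComplex.isKProjective_of_projective _ n

end ProjRes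

/-! ### Homotopy classes of maps and their reduction -/

section Homotopy

open CochainComplex CochainComplex.HomComplex

variable {C D : Type*} [Category* C] [Preadditive C] [Category* D] [Preadditive D]
  {R : Type u} [CommRing R] [Linear R C] {𝔞 : Ideal R}
  {F : ProjectiveResolution (ModuleCat.of R (R ⧸ 𝔞))} {T : C ⥤ D} [T.Additive]
  {P Q : CochainComplex C ℤ}

variable (T P Q) in
/-- The reduction of the complex of homomorphisms from `P` to `Q`. -/
abbrev IsHomReduction (F : ProjectiveResolution (ModuleCat.of R (R ⧸ 𝔞))) : Prop :=
  IsReduction F (fun i => δ_hom R P Q i (i + 1))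
    (fun i => (δ_hom ℤ ((T.mapHomologicalComplex (.up ℤ)).obj P)
      ((T.mapHomologicalComplex (.up ℤ)).obj Q) i (i + 1)).toAddMonoidHom)
    (fun i => cochainMapAddHom P Q i T)

theorem IsHomReduction.map_surjective (h : IsHomReduction T P Q F)
    (h0 : ExactAbove (fun i => (δ_hom ℤ P Q i (i + 1)).toAddMonoidHom) 0) :
    Function.Surjective ((T.mapHomotopyCategory (.up ℤ)).map :
      ((HomotopyCategory.quotient C (.up ℤ)).obj P ⟶
        (HomotopyCategory.quotient C (.up ℤ)).obj Q) → _) := by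
  intro ψ
  obtain ⟨g, rfl⟩ : ∃ g : (T.mapHomologicalComplex (.up ℤ)).obj P ⟶
      (T.mapHomologicalComplex (.up ℤ)).obj Q, (HomotopyCategory.quotient D (.up ℤ)).map g = ψ :=
    (HomotopyCategory.quotient D (.up ℤ)).map_surjective ψ
  obtain ⟨z, hz, hzg⟩ := h.exists_cocycle h0 (Cochain.ofHom g) (δ_ofHom g)
  have h1 : (T.mapHomologicalComplex (.up ℤ)).map (Cocycle.homOf (Cocycle.mk z 1 rfl hz)) = g := by
    apply Cochain.ofHom_injective
    rw [← Cochain.map_ofHom, Cocycle.cochain_ofHom_homOf_eq_coe]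
    exact hzg
  exact ⟨(HomotopyCategory.quotient C (.up ℤ)).map (Cocycle.homOf (Cocycle.mk z 1 rfl hz)),
    congrArg (HomotopyCategory.quotient D (.up ℤ)).map h1⟩

/-- `mem_of_π_eq` with free degrees, for use in degrees `-1`, `0`, `1`. -/
theorem IsHomReduction.mem_sup_of_map_eq_δ (h : IsHomReduction T P Q F) {k n m : ℤ}
    (hkn : k + 1 = n) (hnm : n + 1 = m)
    (hn : ExactAbove (fun i => (δ_hom ℤ P Q i (i + 1)).toAddMonoidHom) n) (z : Cochain P Q n)
    (hz : δ n m z = 0) (y : Cochain ((T.mapHomologicalComplex (.up ℤ)).obj P)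
      ((T.mapHomologicalComplex (.up ℤ)).obj Q) k) (hy : δ k n y = z.map T) :
    z ∈ (δ_hom R P Q k n).range ⊔ 𝔞 • (δ_hom R P Q n m).ker := by
  subst hkn hnm
  exact h.mem_of_π_eq hn z hz y hy

variable (R P Q) in
/-- The homotopy class of the morphism that corresponds to a cocycle of degree zero. -/
noncomputable def cocycleZeroToHom :
    (δ_hom R P Q 0 1).ker →ₗ[R] ((HomotopyCategory.quotient C (.up ℤ)).obj P ⟶
        (HomotopyCategory.quotient C (.up ℤ)).obj Q) where
  toFun z := (HomotopyCategory.quotient C (.up ℤ)).map (Cocycle.homOf (Cocycle.mk z.1 1 rfl z.2))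
  map_add' z z' := by rw [← Functor.map_add]; rfl
  map_smul' r z := by rw [RingHom.id_apply, ← Functor.map_smul]; rfl

/-- A null-homotopy of the reduction exhibits the reduced cocycle as a coboundary, so the cocycle
itself is a coboundary plus an element of `𝔞Z^0`; passing to homotopy classes removes the
coboundary. -/
theorem IsHomReduction.mem_smul_top (h : IsHomReduction T P Q F)
    (h0 : ExactAbove (fun i => (δ_hom ℤ P Q i (i + 1)).toAddMonoidHom) 0)
    (ψ : (HomotopyCategory.quotient C (.up ℤ)).obj P ⟶
        (HomotopyCategory.quotient C (.up ℤ)).obj Q)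
    (hψ : (T.mapHomotopyCategory (.up ℤ)).map ψ = 0) :
    ψ ∈ 𝔞 • (⊤ : Submodule R ((HomotopyCategory.quotient C (.up ℤ)).obj P ⟶
        (HomotopyCategory.quotient C (.up ℤ)).obj Q)) := by
  obtain ⟨g, rfl⟩ := (HomotopyCategory.quotient C (.up ℤ)).map_surjective ψ
  change (HomotopyCategory.quotient D (.up ℤ)).map ((T.mapHomologicalComplex (.up ℤ)).map g) = 0
    at hψ
  rw [HomotopyCategory.quotient_map_eq_zero_iff] at hψ
  obtain ⟨y, hy⟩ := Cochain.equivHomotopy _ _ hψ.some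
  rw [Cochain.ofHom_zero, add_zero, ← Cochain.map_ofHom] at hy
  have h1 : Cochain.ofHom g ∈ (δ_hom R P Q (-1) 0).range ⊔ 𝔞 • (δ_hom R P Q 0 1).ker :=
    h.mem_sup_of_map_eq_δ (by lia) (by lia) h0 (Cochain.ofHom g) (δ_ofHom g) y hy.symm
  obtain ⟨_, ⟨x, rfl⟩, w, hw, hxw⟩ := Submodule.mem_sup.1 h1
  have h2 : 𝔞 • (δ_hom R P Q 0 1).ker =
      (𝔞 • (⊤ : Submodule R (δ_hom R P Q 0 1).ker)).map (δ_hom R P Q 0 1).ker.subtype := by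
    rw [Submodule.map_smul'', Submodule.map_top, Submodule.range_subtype]
  rw [h2] at hw
  obtain ⟨w, hw, rfl⟩ := hw
  have h3 := Submodule.mem_map_of_mem (f := cocycleZeroToHom R P Q) hw
  rw [Submodule.map_smul''] at h3
  have h4 : (HomotopyCategory.quotient C (.up ℤ)).map g = cocycleZeroToHom R P Q w := by
    apply HomotopyCategory.eq_of_homotopy
    refine (Cochain.equivHomotopy _ _).symm ⟨x, ?_⟩
    rw [Cocycle.cochain_ofHom_homOf_eq_coe]
    exact hxw.symm
  rw [h4]
  exact Submodule.smul_mono le_rfl le_top h3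

end Homotopy

/-! ### Reduction of perfect complexes -/

section PerfectReduction

open CochainComplex CochainComplex.HomComplex

theorem exists_complex_of_isPerfect {A : Type u} [Ring A]
    [HasDerivedCategory.{w} (ModuleCat.{u} A)] {X : DerivedCategory (ModuleCat.{u} A)}
    (hX : IsPerfect X) : ∃ (P : CochainComplex (ModuleCat.{u} A) ℤ) (a b : ℤ),
      (∀ i, Module.Finite A (P.X i)) ∧ (∀ i, Module.Projective A (P.X i)) ∧
      P.IsStrictlyGE a ∧ P.IsStrictlyLE b ∧
      Nonempty (DerivedCategory.Qh.obj ((HomotopyCategory.quotient _ (.up ℤ)).obj P) ≅ X) := by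
  obtain ⟨P, hP, ⟨a, ha⟩, ⟨b, hb⟩, ⟨e⟩⟩ := hX
  exact ⟨P, a, b, fun i => (hP i).1, fun i => (hP i).2, ha, hb,
    ⟨(DerivedCategory.quotientCompQhIso _).app P ≪≫ e.symm⟩⟩

theorem isKProjective_of_moduleProjective {A : Type u} [Ring A]
    (P : CochainComplex (ModuleCat.{u} A) ℤ) (b : ℤ) [P.IsStrictlyLE b]
    (h : ∀ i, Module.Projective A (P.X i)) : P.IsKProjective := by
  have : ∀ i, Projective (P.X i) := fun i => (IsProjective.iff_projective _).1 (h i)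
  exact isKProjective_of_projective P b

theorem ncExtendScalars_projective {A B : Type u} [Ring A] [Ring B] (f : A →+* B)
    (X : ModuleCat.{u} A) (hX : Projective X) : Projective ((ncExtendScalars f).obj X) := by
  have : Module.Projective A X := (IsProjective.iff_projective _).2 hX
  exact (IsProjective.iff_projective _).1 (NCExtendScalars.projective (f := f) (P := X))

variable {R : Type u} [CommRing R] {A B : Type u} [Ring A] [Algebra R A] [Ring B] {𝔞 : Ideal R}
  [Algebra (R ⧸ 𝔞) B] {f : A →+* B}
  [HasDerivedCategory.{w} (ModuleCat.{u} A)]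

instance projRes_isKProjective_extendScalars (f : A →+* B) (X : DMinus (ModuleCat.{u} A)) :
    CochainComplex.IsKProjective
      (((ncExtendScalars f).mapHomologicalComplex (.up ℤ)).obj (projRes X).cx) := by
  obtain ⟨n, hn⟩ := (projRes X).bounded
  exact isKProjective_mapHomologicalComplex _ (ncExtendScalars_projective f) _ n
    (projRes X).projective

theorem isHomReduction_of_perfect {F : ProjectiveResolution (ModuleCat.of R (R ⧸ 𝔞))}
    (hA : TorIndependent F A) (hf : Function.Surjective f)
    (hfR : ∀ r, f (algebraMap R A r) = algebraMap (R ⧸ 𝔞) B (Ideal.Quotient.mk 𝔞 r))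
    (hker : ∀ a, f a = 0 → a ∈ 𝔞.map (algebraMap R A))
    (P : CochainComplex (ModuleCat.{u} A) ℤ) (a b : ℤ) [∀ i, Module.Finite A (P.X i)]
    [∀ i, Module.Projective A (P.X i)] [P.IsStrictlyGE a] [P.IsStrictlyLE b]
    (M : DMinus (ModuleCat.{u} A)) :
    IsHomReduction (ncExtendScalars f) P (projRes M).cx F := by
  obtain ⟨n, hn⟩ := (projRes M).bounded
  have : ∀ i, Module.Projective A ((projRes M).cx.X i) := fun i =>
    (IsProjective.iff_projective _).2 ((projRes M).projective i)
  exact isReduction_cochain P (projRes M).cx a b n (ncExtendScalars f)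
    (fun p q => ModuleCat.torIndependent_hom hA _ _)
    (fun p q => ncExtendScalars_map_surjective hf _ _)
    (fun p q g => ncExtendScalars_map_eq_zero_iff hf hfR hker g)

/-- The terms of the chosen resolution need not be finitely generated; the complex `K` of finitely
generated modules representing `M` takes its place. -/
theorem finite_hom_projRes [IsNoetherianRing R] [Module.Finite R A]
    (P : CochainComplex (ModuleCat.{u} A) ℤ) (a b : ℤ) [∀ i, Module.Finite A (P.X i)]
    [P.IsKProjective] [P.IsStrictlyGE a] [P.IsStrictlyLE b]
    {M : DMinus (ModuleCat.{u} A)} (hM : dMinusMod A M.obj) (i : ℤ) :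
    Module.Finite R ((HomotopyCategory.quotient _ (.up ℤ)).obj P ⟶
      (HomotopyCategory.quotient _ (.up ℤ)).obj ((projRes M).cx⟦i⟧)) := by
  obtain ⟨K, hK, -, ⟨e⟩⟩ := hM
  have : ∀ p, Module.Finite A ((K⟦i⟧).X p) := fun p => hK (p + i)
  have : Module.Finite R (P ⟶ K⟦i⟧) :=
    finite_hom_of_bounded P (K⟦i⟧) a b fun p q => ModuleCat.finite_hom _ _
  let c := DerivedCategory.quotientCompQhIso (ModuleCat.{u} A)
  refine finite_homotopyCategory_hom (L' := K⟦i⟧) ?_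
  exact c.app _ ≪≫ (DerivedCategory.Q.commShiftIso i).app K ≪≫
    (CategoryTheory.shiftFunctor _ i).mapIso (e.symm ≪≫ (projRes M).iso.symm ≪≫ c.app _) ≪≫
    ((DerivedCategory.Q.commShiftIso i).symm.app (projRes M).cx) ≪≫ c.symm.app _

variable [HasDerivedCategory.{w'} (ModuleCat.{u} B)]

theorem bijective_Qh_map_extendScalars (f : A →+* B) (X : DMinus (ModuleCat.{u} A))
    (Y : HomotopyCategory (ModuleCat.{u} B) (.up ℤ)) :
    Function.Bijective (DerivedCategory.Qh.map :
      (((ncExtendScalars f).mapHomotopyCategory (.up ℤ)).obj (projResObj X) ⟶ Y) → _) :=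
  IsKProjective.Qh_map_bijective
    (((ncExtendScalars f).mapHomologicalComplex (.up ℤ)).obj (projRes X).cx) Y

/-- The derived functor may be computed from any K-projective representative, in particular from a
bounded complex of finitely generated projectives. -/
theorem exists_iso_reduction (f : A →+* B) {X : DMinus (ModuleCat.{u} A)}
    {K : CochainComplex (ModuleCat.{u} A) ℤ} [K.IsKProjective]
    (e : DerivedCategory.Qh.obj ((HomotopyCategory.quotient _ (.up ℤ)).obj K) ≅ X.obj) :
    Nonempty (DerivedCategory.Qh.obj ((HomotopyCategory.quotient _ (.up ℤ)).obj
      (((ncExtendScalars f).mapHomologicalComplex (.up ℤ)).obj K)) ≅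
        (leftDerivedMinus (ncExtendScalars f)).obj X) := by
  obtain ⟨e'⟩ := exists_iso_projResObj e
  exact ⟨DerivedCategory.Qh.mapIso (((ncExtendScalars f).mapHomotopyCategory (.up ℤ)).mapIso e')⟩

variable {F : ProjectiveResolution (ModuleCat.of R (R ⧸ 𝔞))}

/-- Vanishing of morphisms out of a perfect complex in large degrees can be tested after
reduction. -/
theorem forall_hom_eq_zero_iff_reduction [IsNoetherianRing R] [Module.Finite R A]
    (h𝔞 : 𝔞 ≤ (⊥ : Ideal R).jacobson)
    (hA : TorIndependent F A) (hf : Function.Surjective f)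
    (hfR : ∀ r, f (algebraMap R A r) = algebraMap (R ⧸ 𝔞) B (Ideal.Quotient.mk 𝔞 r))
    (hker : ∀ a, f a = 0 → a ∈ 𝔞.map (algebraMap R A))
    {L M : DMinus (ModuleCat.{u} A)} (hL : IsPerfect L.obj) (hM : dMinusMod A M.obj) (m : ℤ) :
    (∀ i, m < i → ∀ φ : L.obj ⟶ M.obj⟦i⟧, φ = 0) ↔
      ∀ i, m < i → ∀ φ : (leftDerivedMinus (ncExtendScalars f)).obj L ⟶
        ((leftDerivedMinus (ncExtendScalars f)).obj M)⟦i⟧, φ = 0 := by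
  obtain ⟨P, a, b, hP, hP', ha, hb, ⟨e⟩⟩ := exists_complex_of_isPerfect hL
  have := isKProjective_of_moduleProjective P b hP'
  have : CochainComplex.IsKProjective
      (((ncExtendScalars f).mapHomologicalComplex (.up ℤ)).obj P) :=
    isKProjective_mapHomologicalComplex _ (ncExtendScalars_projective f) P b
      fun i => (IsProjective.iff_projective _).1 (hP' i)
  obtain ⟨e'⟩ := exists_iso_reduction f e
  have h := isHomReduction_of_perfect hA hf hfR hker P a b M
  rw [← exactAbove_iff e (projRes M).iso m, ← exactAbove_iff e'
    (Iso.refl ((leftDerivedMinus (ncExtendScalars f)).obj M)) m]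
  refine ⟨fun hm => h.exactAbove hm, fun hm => h.exactAbove_of_reduction h𝔞 (fun i => ?_) hm⟩
  have := finite_hom_projRes (R := R) P a b hM (i + 1)
  exact exists_fg_cocycles P (projRes M).cx i

/-- Both the resolution of `L` and its reduction are K-projective, so the question moves to homotopy
classes of maps. There the resolution is replaced by `P`, and degree-zero cocycles lift. -/
theorem leftDerivedMinus_map_surjective
    (hA : TorIndependent F A) (hf : Function.Surjective f)
    (hfR : ∀ r, f (algebraMap R A r) = algebraMap (R ⧸ 𝔞) B (Ideal.Quotient.mk 𝔞 r))
    (hker : ∀ a, f a = 0 → a ∈ 𝔞.map (algebraMap R A))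
    {L M : DMinus (ModuleCat.{u} A)} (hL : IsPerfect L.obj) (hLM : SiltGE L.obj M.obj) :
    Function.Surjective ((leftDerivedMinus (ncExtendScalars f)).map :
      (L ⟶ M) → ((leftDerivedMinus (ncExtendScalars f)).obj L ⟶ _)) := by
  obtain ⟨P, a, b, hP, hP', ha, hb, ⟨e⟩⟩ := exists_complex_of_isPerfect hL
  have := isKProjective_of_moduleProjective P b hP'
  have h := isHomReduction_of_perfect hA hf hfR hker P a b M
  obtain ⟨e'⟩ := exists_iso_projResObj e
  let T := (ncExtendScalars f).mapHomotopyCategory (.up ℤ)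
  intro φ
  obtain ⟨ψ, hψ⟩ : ∃ ψ : T.obj (projResObj L) ⟶ T.obj (projResObj M),
      DerivedCategory.Qh.map ψ = φ :=
    (bijective_Qh_map_extendScalars f L (T.obj (projResObj M))).surjective φ
  obtain ⟨g, hg⟩ := h.map_surjective ((exactAbove_iff e (projRes M).iso 0).2 hLM)
    (T.map e'.hom ≫ ψ)
  obtain ⟨φ', hφ'⟩ := projResMap_surjective (e'.inv ≫ g)
  refine ⟨φ', ?_⟩
  change DerivedCategory.Qh.map (T.map (projResMap φ')) = φ
  rw [hφ', T.map_comp, hg, ← T.map_comp_assoc, e'.inv_hom_id, T.map_id, Category.id_comp]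
  exact hψ

theorem mem_smul_top_of_leftDerivedMinus_map_eq_zero
    (hA : TorIndependent F A) (hf : Function.Surjective f)
    (hfR : ∀ r, f (algebraMap R A r) = algebraMap (R ⧸ 𝔞) B (Ideal.Quotient.mk 𝔞 r))
    (hker : ∀ a, f a = 0 → a ∈ 𝔞.map (algebraMap R A))
    {L M : DMinus (ModuleCat.{u} A)} (hL : IsPerfect L.obj) (hLM : SiltGE L.obj M.obj)
    (φ : L ⟶ M) (hφ : (leftDerivedMinus (ncExtendScalars f)).map φ = 0) :
    φ.hom ∈ 𝔞 • (⊤ : Submodule R (L.obj ⟶ M.obj)) := by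
  obtain ⟨P, a, b, hP, hP', ha, hb, ⟨e⟩⟩ := exists_complex_of_isPerfect hL
  have := isKProjective_of_moduleProjective P b hP'
  have h := isHomReduction_of_perfect hA hf hfR hker P a b M
  obtain ⟨e'⟩ := exists_iso_projResObj e
  let T := (ncExtendScalars f).mapHomotopyCategory (.up ℤ)
  have h1 : T.map (projResMap φ) = 0 :=
    (bijective_Qh_map_extendScalars f L (T.obj (projResObj M))).injective (by
        rw [Functor.map_zero]
        exact hφ)
  have h2 := h.mem_smul_top ((exactAbove_iff e (projRes M).iso 0).2 hLM)
    (e'.hom ≫ projResMap φ) (by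
      change T.map _ = 0
      rw [T.map_comp, h1, comp_zero])
  let κ : ((HomotopyCategory.quotient _ (.up ℤ)).obj P ⟶ projResObj M) →ₗ[R] (L.obj ⟶ M.obj) :=
    Linear.leftComp R _ (projRes L).iso.inv ∘ₗ Linear.rightComp R _ (projRes M).iso.hom ∘ₗ
      DerivedCategory.Qh.mapLinearMap R ∘ₗ Linear.leftComp R _ e'.inv
  have h3 := Submodule.mem_map_of_mem (f := κ) h2
  have h4 : κ (e'.hom ≫ projResMap φ) = φ.hom := by
    rw [hom_eq_of_projResMap]
    change _ ≫ DerivedCategory.Qh.map (e'.inv ≫ e'.hom ≫ projResMap φ) ≫ _ = _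
    rw [e'.inv_hom_id_assoc]
  rw [Submodule.map_smul'', h4] at h3
  exact Submodule.smul_mono le_rfl le_top h3

theorem leftDerivedMinus_map_add {L M : DMinus (ModuleCat.{u} A)} (φ ψ : L ⟶ M) :
    (leftDerivedMinus (ncExtendScalars f)).map (φ + ψ) =
      (leftDerivedMinus (ncExtendScalars f)).map φ +
        (leftDerivedMinus (ncExtendScalars f)).map ψ := by
  change DerivedCategory.Qh.map (((ncExtendScalars f).mapHomotopyCategory (.up ℤ)).map
    (projResMap (φ + ψ))) = _
  rw [projResMap_add, Functor.map_add, Functor.map_add]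
  rfl

theorem leftDerivedMinus_map_smul
    (hfR : ∀ r, f (algebraMap R A r) = algebraMap (R ⧸ 𝔞) B (Ideal.Quotient.mk 𝔞 r))
    {L M : DMinus (ModuleCat.{u} A)} (r : R) (φ : L.obj ⟶ M.obj) :
    (leftDerivedMinus (ncExtendScalars f)).map (ObjectProperty.homMk (r • φ) : L ⟶ M) =
      Ideal.Quotient.mk 𝔞 r •
        (leftDerivedMinus (ncExtendScalars f)).map (ObjectProperty.homMk φ : L ⟶ M) := by
  let T := (ncExtendScalars f).mapHomotopyCategory (.up ℤ)
  have h1 : projResMap (ObjectProperty.homMk (r • φ) : L ⟶ M) =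
      r • projResMap (ObjectProperty.homMk φ : L ⟶ M) :=
    (projResMap_unique _ _ (by
      rw [Functor.map_smul, Linear.smul_comp, projResMap_comm, ← Linear.comp_smul]
      rfl)).symm
  have h2 : ∀ ψ : projResObj L ⟶ projResObj M,
      T.map (r • ψ) = Ideal.Quotient.mk 𝔞 r • T.map ψ := fun ψ => by
    obtain ⟨g, rfl⟩ := (HomotopyCategory.quotient _ (.up ℤ)).map_surjective ψ
    have h3 : ((ncExtendScalars f).mapHomologicalComplex (.up ℤ)).map (r • g) =
        Ideal.Quotient.mk 𝔞 r • ((ncExtendScalars f).mapHomologicalComplex (.up ℤ)).map g := by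
      ext1 i
      exact ncExtendScalars_map_smul hfR r (g.f i)
    rw [← Functor.map_smul]
    change (HomotopyCategory.quotient _ (.up ℤ)).map
      (((ncExtendScalars f).mapHomologicalComplex (.up ℤ)).map (r • g)) = _
    rw [h3, Functor.map_smul]
    rfl
  change DerivedCategory.Qh.map (T.map (projResMap _)) = _
  rw [h1, h2, Functor.map_smul]
  rfl

end PerfectReduction

/-! ### Endomorphism algebras -/

section EndAlgebra

/-- The tensor product is `E / 𝔞E`, and `Φ` kills `𝔞E` by `hΦ`; so surjectivity and one inclusion
for the kernel suffice. -/
theorem nonempty_tensorQuotient_algEquiv {R : Type*} [CommRing R] {𝔞 : Ideal R} {E E' : Type*}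
    [Ring E] [Algebra R E] [Ring E'] [Algebra (R ⧸ 𝔞) E'] (Φ : E →+* E')
    (hΦ : ∀ r, Φ (algebraMap R E r) = algebraMap (R ⧸ 𝔞) E' (Ideal.Quotient.mk 𝔞 r))
    (hsurj : Function.Surjective Φ) (hker : ∀ x, Φ x = 0 → x ∈ 𝔞 • (⊤ : Submodule R E)) :
    Nonempty ((R ⧸ 𝔞) ⊗[R] E ≃ₐ[R ⧸ 𝔞] E') := by
  let : Algebra R E' := Algebra.compHom E' (Ideal.Quotient.mk 𝔞)
  have : IsScalarTower R (R ⧸ 𝔞) E' := IsScalarTower.of_algebraMap_eq fun _ => rfl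
  let Φ' : E →ₐ[R] E' := { Φ with commutes' := hΦ }
  let Ψ : (R ⧸ 𝔞) ⊗[R] E →ₐ[R ⧸ 𝔞] E' := Algebra.TensorProduct.lift (Algebra.ofId (R ⧸ 𝔞) E') Φ'
    fun r x => Algebra.commutes r (Φ' x)
  have hΨ : ∀ x, Ψ (1 ⊗ₜ x) = Φ x := fun x =>
    (Algebra.TensorProduct.lift_tmul _ _ _ _ _).trans (by rw [map_one, one_mul]; rfl)
  refine ⟨AlgEquiv.ofBijective Ψ ⟨?_, fun y => ?_⟩⟩
  · rw [injective_iff_map_eq_zero]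
    intro t ht
    obtain ⟨x, rfl⟩ := TensorProduct.mk_surjective R E (R ⧸ 𝔞) Ideal.Quotient.mk_surjective t
    change Ψ (1 ⊗ₜ x) = 0 at ht
    rw [hΨ] at ht
    refine Submodule.smul_induction_on (hker x ht) (fun r hr x _ => ?_) (fun x y hx hy => ?_)
    · change (1 : R ⧸ 𝔞) ⊗ₜ[R] (r • x) = 0
      rw [← TensorProduct.smul_tmul, Algebra.smul_def, Ideal.Quotient.algebraMap_eq,
        Ideal.Quotient.eq_zero_iff_mem.2 hr, zero_mul, TensorProduct.zero_tmul]
    · rw [map_add, hx, hy, add_zero]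
  · obtain ⟨x, rfl⟩ := hsurj y
    exact ⟨1 ⊗ₜ x, hΨ x⟩

variable {R : Type u} [CommRing R] {A B : Type u} [Ring A] [Algebra R A] [Ring B] {𝔞 : Ideal R}
  [Algebra (R ⧸ 𝔞) B] {f : A →+* B} [HasDerivedCategory.{w} (ModuleCat.{u} A)]
  [HasDerivedCategory.{w'} (ModuleCat.{u} B)]

variable (f) in
/-- The left derived functor of extension of scalars, as a ring homomorphism between
endomorphism rings. -/
noncomputable def leftDerivedMinusEnd (X : DMinus (ModuleCat.{u} A)) :
    End X.obj →+* End ((leftDerivedMinus (ncExtendScalars f)).obj X) where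
  toFun φ := (leftDerivedMinus (ncExtendScalars f)).map (ObjectProperty.homMk φ : X ⟶ X)
  map_one' := (leftDerivedMinus (ncExtendScalars f)).map_id X
  map_mul' φ ψ := (leftDerivedMinus (ncExtendScalars f)).map_comp
    (ObjectProperty.homMk ψ : X ⟶ X) (ObjectProperty.homMk φ : X ⟶ X)
  map_zero' := by
    have h := leftDerivedMinus_map_add (f := f) (0 : X ⟶ X) 0
    rw [add_zero] at h
    exact left_eq_add.1 h
  map_add' φ ψ := leftDerivedMinus_map_add (ObjectProperty.homMk φ : X ⟶ X)
    (ObjectProperty.homMk ψ : X ⟶ X)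

theorem nonempty_end_algEquiv {F : ProjectiveResolution (ModuleCat.of R (R ⧸ 𝔞))}
    (hA : TorIndependent F A) (hf : Function.Surjective f)
    (hfR : ∀ r, f (algebraMap R A r) = algebraMap (R ⧸ 𝔞) B (Ideal.Quotient.mk 𝔞 r))
    (hker : ∀ a, f a = 0 → a ∈ 𝔞.map (algebraMap R A))
    {X : DMinus (ModuleCat.{u} A)} (hX : IsPresilting X.obj) :
    Nonempty ((R ⧸ 𝔞) ⊗[R] End X.obj ≃ₐ[R ⧸ 𝔞]
      End ((leftDerivedMinus (ncExtendScalars f)).obj X)) := by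
  refine nonempty_tensorQuotient_algEquiv (leftDerivedMinusEnd f X) (fun r => ?_) (fun φ => ?_)
    (fun φ hφ => ?_)
  · refine (leftDerivedMinus_map_smul hfR r (𝟙 X.obj)).trans ?_
    exact congrArg (Ideal.Quotient.mk 𝔞 r • ·)
      ((leftDerivedMinus (ncExtendScalars f)).map_id X)
  · obtain ⟨ψ, rfl⟩ := leftDerivedMinus_map_surjective hA hf hfR hker hX.1 hX.2 φ
    exact ⟨ψ.hom, rfl⟩
  · exact mem_smul_top_of_leftDerivedMinus_map_eq_zero hA hf hfR hker hX.1 hX.2 _ hφ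

end EndAlgebra

/-! ### The theorem for right modules, through the opposite algebra -/

theorem mainTheorem3 {R : Type u} [CommRing R] [IsNoetherianRing R] [IsLocalRing R]
    [IsAdicComplete (IsLocalRing.maximalIdeal R) R]
    {Λ : Type u} [Ring Λ] [Algebra R Λ] [Module.Finite R Λ]
    (𝔞 : Ideal R) (h𝔞 : 𝔞 ≠ ⊤)
    (hTor : ∀ n : ℕ, 0 < n →
      IsZero (((Tor (ModuleCat.{u} R) n).obj (ModuleCat.of R Λ)).obj (ModuleCat.of R (R ⧸ 𝔞))))
    [HasDerivedCategory.{w} (ModuleCat.{u} Λᵐᵒᵖ)]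
    [HasDerivedCategory.{w'} (ModuleCat.{u} (RedAlg Λ 𝔞)ᵐᵒᵖ)] :
    (∀ L M : DMinusMod Λᵐᵒᵖ, IsPerfect L.obj →
      (SiltGE L.obj M.obj ↔ SiltGE ((reduction Λ 𝔞).obj L) ((reduction Λ 𝔞).obj M)) ∧
      (SiltGE ((reduction Λ 𝔞).obj L) ((reduction Λ 𝔞).obj M) →
        Function.Surjective (fun φ : L ⟶ M => (reduction Λ 𝔞).map φ)) ∧
      (SiltPerp L.obj M.obj ↔ SiltPerp ((reduction Λ 𝔞).obj L) ((reduction Λ 𝔞).obj M))) ∧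
    (∀ L : DMinusMod Λᵐᵒᵖ, IsPresilting L.obj →
      Nonempty ((R ⧸ 𝔞) ⊗[R] End L.obj ≃ₐ[R ⧸ 𝔞] End ((reduction Λ 𝔞).obj L))) := by
  let F := projectiveResolution (ModuleCat.of R (R ⧸ 𝔞))
  have hA : TorIndependent F Λᵐᵒᵖ :=
    (torIndependent_of_isZero_tor F Λ hTor).of_linearEquiv (MulOpposite.opLinearEquiv R)
  have h𝔞' : 𝔞 ≤ (⊥ : Ideal R).jacobson :=
    (IsLocalRing.le_maximalIdeal h𝔞).trans (IsLocalRing.jacobson_eq_maximalIdeal _ bot_ne_top).ge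
  have : Module.Finite R Λᵐᵒᵖ := Module.Finite.equiv (MulOpposite.opLinearEquiv R)
  let f := (Ideal.Quotient.mk (extIdeal Λ 𝔞)).op
  have hf : Function.Surjective f := fun b => by
    obtain ⟨a, ha⟩ := Ideal.Quotient.mk_surjective b.unop
    exact ⟨MulOpposite.op a, MulOpposite.unop_injective ha⟩
  have hfR : ∀ r, f (algebraMap R Λᵐᵒᵖ r) =
      algebraMap (R ⧸ 𝔞) (RedAlg Λ 𝔞)ᵐᵒᵖ (Ideal.Quotient.mk 𝔞 r) := fun r => rfl
  have hker : ∀ a, f a = 0 → a ∈ 𝔞.map (algebraMap R Λᵐᵒᵖ) := fun a ha => by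
    have h1 : a.unop ∈ extIdeal Λ 𝔞 :=
      Ideal.Quotient.eq_zero_iff_mem.1 (congrArg MulOpposite.unop ha)
    have h2 : ∀ x ∈ extIdeal Λ 𝔞, MulOpposite.op x ∈ 𝔞.map (algebraMap R Λᵐᵒᵖ) := fun x hx => by
      induction hx using Submodule.span_induction with
      | mem x hx =>
        obtain ⟨r, hr, rfl⟩ := hx
        exact Ideal.mem_map_of_mem (algebraMap R Λᵐᵒᵖ) hr
      | zero => exact zero_mem _
      | add x y _ _ hx hy => exact add_mem hx hy
      -- Passing to the opposite ring turns the left multiple `a * x` into a right multiple, so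
      -- two-sidedness of the extended ideal is needed.
      | smul a x _ hx => exact (extIdeal Λᵐᵒᵖ 𝔞).mul_mem_right (MulOpposite.op a) hx
    exact h2 _ h1
  let ι := ObjectProperty.ιOfLE (dMinusMod_le_minus (A := Λᵐᵒᵖ))
  have key : ∀ (L M : DMinusMod Λᵐᵒᵖ), IsPerfect L.obj → ∀ m : ℤ,
      (∀ i, m < i → ∀ φ : L.obj ⟶ M.obj⟦i⟧, φ = 0) ↔
        ∀ i, m < i → ∀ φ : (reduction Λ 𝔞).obj L ⟶ ((reduction Λ 𝔞).obj M)⟦i⟧, φ = 0 :=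
    fun L M hL m => forall_hom_eq_zero_iff_reduction h𝔞' hA hf hfR hker
      (L := ι.obj L) (M := ι.obj M) hL M.property m
  refine ⟨fun L M hL => ⟨key L M hL 0, fun h φ => ?_, ?_⟩, fun L hL => ?_⟩
  · obtain ⟨ψ, hψ⟩ := leftDerivedMinus_map_surjective hA hf hfR hker
      (L := ι.obj L) (M := ι.obj M) hL ((key L M hL 0).2 h) φ
    exact ⟨ObjectProperty.homMk ψ.hom, hψ⟩
  -- The case of degree `i` is read off from the comparison above the threshold `i - 1`.
  · exact ⟨fun h i => (key L M hL (i - 1)).1 (fun j _ => h j) i (by lia),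
      fun h i => (key L M hL (i - 1)).2 (fun j _ => h j) i (by lia)⟩
  · exact nonempty_end_algEquiv hA hf hfR hker (X := ι.obj L) hL
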